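/- **Problem.** Let $N\ge 2$, $m\ge 0$, $D=[-1/2,1/2]^N$, $Q_1=D$, $Q_{i+1}=\{y\in Q_i: G_i(y)\le 0\}$ ($1\le i\le m$), where each $G_i$ ($1\le i\le m+1$) is a real function on $Q_i$ that is Lipschitz on $Q_i$ (Euclidean norm). Assume that each $Q_i$, $2\le i\le m+1$, is a finite union of disjoint sub-regions with non-empty interior each of which is robust (a set $B$ is robust if for every boundary point $\beta$ of $B$ and every $\varepsilon>0$ the set $B\cap\{y:\|y-\beta\|<\varepsilon\}$ has non-empty interior), that $Q_{m+1}\neq\emptyset$, and that the problem $\min\{G_{m+1}(y):y\in Q_{m+1}\}$ has a unique solution $y^*$. Let $\varepsilon(y^*)$ be the open ball of radius $\varepsilon>0$ about $y^*$. **Curve.** Take a Peano (Hilbert) type curve: for every $d$ the $2^{Nd}$ dyadic subcubes of $D$ of edge $2^{-d}$ are numbered $0,\dots,2^{Nd}-1$ so that consecutive cubes share a facet and the subcubes of the $s$-th cube of level $d$ are those numbered $2^Ns,\dots,2^N(s+1)-1$ at level $d+1$. Its level-$d$ approximation $y_d:[0,1]\to D$ is the broken line through the centres of the level-$d$ subcubes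 in this order, each link being run through linearly in equal time. Put $g_i(x)=G_i(y_d(x))$. The index $\nu(x)\in\{1,\dots,m+1\}$ is the least $i\le m$ with $g_i(x)>0$, and $m+1$ if there is none. Let $g^*_{m+1}$ be the minimum of $g_{m+1}(x)$ over the $x\in[0,1]$ with $y_d(x)\in Q_{m+1}$, and $\Phi(x)=g_{\nu(x)}(x)$ if $\nu(x)<m+1$, $\Phi(x)=g_{m+1}(x)-g^*_{m+1}$ if $\nu(x)=m+1$. **Algorithm** (parameters $r>1$, $\xi>0$; no stopping). $x^0=0$, $x^1=1$. Given $x^0,\dots,x^k$ ($k\ge1$), order them as $0=x_0<\dots<x_k=1$; put $\nu_i=\nu(x_i)$, $\Delta_i=(x_i-x_{i-1})^{1/N}$, $z_i=g_{\nu_i}(x_i)$ if $\nu_i<m+1$ and $z_i=g_{m+1}(x_i)-z_k^*$ if $\nu_i=m+1$, where $z_k^*=\min\{g_{m+1}(x_i):\nu_i=m+1\}$. Let $\mu_j=\max\{|z_p-z_q|/(x_p-x_q)^{1/N}: q<p,\ \nu_p=\nu_q=j\}$ ($0$ if there is no such pair), $X_j^{\max}=\max\{\Delta_i:\max\{\nu_i,\nu_{i-1}\}=j\}$,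 $\gamma_i=\mu_j\Delta_i/X_j^{\max}$ with $j=\max\{\nu_i,\nu_{i-1}\}$, $\lambda_i=\max\{l_i,c_i,r_i\}$, $M_i=\max\{\lambda_i,\gamma_i,\xi\}$, where $c_i=|z_i-z_{i-1}|/\Delta_i$ if $\nu_i=\nu_{i-1}$; $l_i=|z_{i-1}-z_{i-2}|/\Delta_{i-1}$ if $i\ge2$, $\nu_{i-2}=\nu_{i-1}\ge\nu_i$; $r_i=|z_{i+1}-z_i|/\Delta_{i+1}$ if $i\le k-1$, $\nu_{i+1}=\nu_i\ge\nu_{i-1}$; and these are $0$ otherwise. Let $R_i=\Delta_i+\frac{(z_i-z_{i-1})^2}{(rM_i)^2\Delta_i}-\frac{2(z_i+z_{i-1})}{rM_i}$ if $\nu_i=\nu_{i-1}$, $R_i=2\Delta_i-\frac{4z_i}{rM_i}$ if $\nu_i>\nu_{i-1}$, $R_i=2\Delta_i-\frac{4z_{i-1}}{rM_i}$ if $\nu_i<\nu_{i-1}$. Let $t$ be the least index with $R_t=\max_{1\le i\le k}R_i$. Then $x^{k+1}=\frac{x_t+x_{t-1}}2-\frac{\mathrm{sign}(z_t-z_{t-1})|z_t-z_{t-1}|^N}{2rM_t^N}$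 if $\nu_t=\nu_{t-1}$, and $x^{k+1}=\frac{x_t+x_{t-1}}2$ otherwise. **Condition $(\ast)$** for a point $x^*$ and the interval $[x_{j-1},x_j]\ni x^*$, $j=j(k)$, in the $k$-th iteration: $rM_j>B_j$, where $B_j=2^{1-1/N}C_j+\sqrt{2^{2-2/N}C_j^2-D_j^2}$ if $\nu_{j-1}=\nu_j$ and $B_j=2C_j$ otherwise; $C_j=\frac{z_{j-1}}{(x^*-x_{j-1})^{1/N}}$ if $\nu_{j-1}>\nu_j$, $C_j=\frac{z_j}{(x_j-x^*)^{1/N}}$ if $\nu_{j-1}<\nu_j$, $C_j$ is the maximum of both if $\nu_{j-1}=\nu_j$ (a quotient with denominator $0$ is read as $0$); $D_j=|z_j-z_{j-1}|/(x_j-x_{j-1})^{1/N}$ if $\nu_{j-1}=\nu_j$. **Statement.** For every such problem, curve and $\varepsilon>0$ there is a level $d_0$ such that for every $d\ge d_0$: the problem $\min\{\Phi(x):x\in[0,1]\}$ has a solution; every solution $x^*$ satisfies $y_d(x^*)\in Q_{m+1}\cap\varepsilon(y^*)$; and if a solution $x^*$ lies in a segment $[a,b]\subset[0,1]$, $a<b$,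 with $h=y_d([a,b])\subset Q_{m+1}$, then for all $r>1$ and $\xi>0$ the following holds. Let $j(k)$ be the number of an interval $[x_{j-1},x_j]$ containing $x^*$ in the $k$-th iteration (if $x^*$ is itself a trial point: one that overlaps $[a,b]$ in more than a point). If $(\ast)$ holds for all $k\ge k^*$ and $rM_{j(k)}-B_{j(k)}$ does not tend to $0$ as $k\to\infty$, then $y_d(x^k)\in Q_{m+1}\cap\varepsilon(y^*)$ for infinitely many $k$; so the algorithm produces feasible $\varepsilon$-approximations of the global solution. -/

import Mathlib

open Set Filter Topology

noncomputable section

namespace IndexMethod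

/-- Euclidean space `ℝ^N`. -/
abbrev E (N : ℕ) : Type := EuclideanSpace ℝ (Fin N)

/-! ### The constrained problem -/

/-- The search domain `D = [-1/2, 1/2]^N`. -/
def domain (N : ℕ) : Set (E N) := {y | ∀ i, -(1 / 2 : ℝ) ≤ y i ∧ y i ≤ 1 / 2}

/-- The regions `Q_1 = D`, `Q_{i+1} = {y ∈ Q_i : G_i(y) ≤ 0}`. The functions are numbered
`G_1, …, G_{m+1}` (the last one is the objective); the values of `G_i` outside `Q_i` are never
used, so that `G_i` is in effect a function on `Q_i`. -/
def region {N : ℕ} (G : ℕ → E N → ℝ) (i : ℕ) : Set (E N) :=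
  {y | y ∈ domain N ∧ ∀ l, 1 ≤ l → l < i → G l y ≤ 0}

/-- `B` is robust: every neighbourhood of every boundary point of `B` meets `B` in a set of
positive volume, in the sense that the intersection contains a nonempty open set. -/
def IsRobust {N : ℕ} (B : Set (E N)) : Prop :=
  ∀ β ∈ frontier B, ∀ ε : ℝ, 0 < ε → (interior (Metric.ball β ε ∩ B)).Nonempty

/-- `Q` is a finite union of disjoint robust sub-regions with nonempty interior. -/
def IsRobustUnion {N : ℕ} (Q : Set (E N)) : Prop :=
  ∃ (T : ℕ) (P : Fin T → Set (E N)), (∀ a b, a ≠ b → Disjoint (P a) (P b)) ∧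
    Q = ⋃ a, P a ∧ ∀ a, (interior (P a)).Nonempty ∧ IsRobust (P a)

/-! ### Peano-type curves and their polygonal approximations -/

/-- A Peano-type (Hilbert-type) numbering of the dyadic subcubes of `D`. For each level `d`, the
`2^(N d)` subcubes of edge `2^(-d)` (a subcube is given by its integer coordinates in
`{0, …, 2^d - 1}^N`) are numbered from `0` to `2^(N d) - 1`, such that the subcubes of the `s`-th
cube of level `d` are exactly the cubes of level `d + 1` with numbers in
`[2^N s, 2^N (s + 1))`, and cubes with consecutive numbers have a common facet. -/
structure PeanoNumbering (N : ℕ) where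
  cube : ℕ → ℕ → Fin N → ℕ
  bijOn : ∀ d, BijOn (cube d) {s | s < 2 ^ (N * d)} {c | ∀ i, c i < 2 ^ d}
  nested : ∀ d s, s < 2 ^ (N * (d + 1)) → ∀ i, cube (d + 1) s i / 2 = cube d (s / 2 ^ N) i
  adjacent : ∀ d s, s + 1 < 2 ^ (N * d) →
    ∃ i, (cube d (s + 1) i = cube d s i + 1 ∨ cube d s i = cube d (s + 1) i + 1) ∧
      ∀ l, l ≠ i → cube d (s + 1) l = cube d s l

/-- The centre of the `s`-th subcube of level `d`. -/
def PeanoNumbering.center {N : ℕ} (P : PeanoNumbering N) (d s : ℕ) : E N :=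
  WithLp.toLp 2 fun i => -(1 / 2 : ℝ) + ((P.cube d s i : ℝ) + 1 / 2) / 2 ^ d

/-- The level-`d` approximation `y_d : [0,1] → D` of the curve: the broken line through the
centres of the level-`d` subcubes in the order of their numbers, each of its `2^(N d) - 1` links
being run through linearly in the same time. -/
def PeanoNumbering.curve {N : ℕ} (P : PeanoNumbering N) (d : ℕ) (x : ℝ) : E N :=
  let w : ℝ := x * ((2 : ℝ) ^ (N * d) - 1)
  P.center d ⌊w⌋₊ + (w - (⌊w⌋₊ : ℝ)) • (P.center d (⌊w⌋₊ + 1) - P.center d ⌊w⌋₊)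

/-- The reduced functions `g_i(x) = G_i(y_d(x))`. -/
def reduced {N : ℕ} (P : PeanoNumbering N) (G : ℕ → E N → ℝ) (d : ℕ) (i : ℕ) (x : ℝ) : ℝ :=
  G i (P.curve d x)

/-! ### The index scheme on `[0,1]` -/

/-- The index `ν(x) ∈ {1, …, m+1}`: the number of the first constraint violated at `x`, and `m+1`
if there is none. -/
def index (m : ℕ) (g : ℕ → ℝ → ℝ) (x : ℝ) : ℕ :=
  sInf {i | 1 ≤ i ∧ (i = m + 1 ∨ 0 < g i x)}

/-- The optimal value `g*_{m+1}` of the reduced constrained problem. -/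
def optValue (m : ℕ) (g : ℕ → ℝ → ℝ) : ℝ :=
  sInf (g (m + 1) '' {x | x ∈ Icc (0 : ℝ) 1 ∧ ∀ l, 1 ≤ l → l < m + 1 → g l x ≤ 0})

/-- The function `Φ` of the index scheme. -/
def Phi (m : ℕ) (g : ℕ → ℝ → ℝ) (x : ℝ) : ℝ :=
  g (index m g x) x - if index m g x = m + 1 then optValue m g else 0

/-- `x` solves the unconstrained problem `Φ(x) = min {Φ(x') : x' ∈ [0,1]}`. -/
def IsSolution (m : ℕ) (g : ℕ → ℝ → ℝ) (x : ℝ) : Prop :=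
  x ∈ Icc (0 : ℝ) 1 ∧ ∀ x' ∈ Icc (0 : ℝ) 1, Phi m g x ≤ Phi m g x'

/-! ### One iteration of the algorithm

Below, `p 0 < p 1 < ⋯ < p k` are the trial points of the first `k` iterations in increasing
order; only these values of `p : ℕ → ℝ` are used. -/

/-- The length `(b - a)^(1/N)` of `[a, b]` in the Hölder metric. -/
def hlen (N : ℕ) (a b : ℝ) : ℝ := (b - a) ^ (1 / (N : ℝ))

/-- The best value `z*_k` of the objective found so far. It is used only if there is a trial point
of index `m+1`. -/
def bestValue (m : ℕ) (g : ℕ → ℝ → ℝ) (k : ℕ) (p : ℕ → ℝ) : ℝ :=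
  sInf {v | ∃ i, i ≤ k ∧ index m g (p i) = m + 1 ∧ v = g (m + 1) (p i)}

/-- The values `z_i`. -/
def zval (m : ℕ) (g : ℕ → ℝ → ℝ) (k : ℕ) (p : ℕ → ℝ) (i : ℕ) : ℝ :=
  g (index m g (p i)) (p i) - if index m g (p i) = m + 1 then bestValue m g k p else 0

/-- The difference quotient `|z_i - z_l| / (x_i - x_l)^(1/N)`. -/
def slope (N m : ℕ) (g : ℕ → ℝ → ℝ) (k : ℕ) (p : ℕ → ℝ) (l i : ℕ) : ℝ :=
  |zval m g k p i - zval m g k p l| / hlen N (p l) (p i)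

/-- The lower bounds `μ_j` of the global Hölder constants (`0` if there is no pair of points). -/
def muBound (N m : ℕ) (g : ℕ → ℝ → ℝ) (k : ℕ) (p : ℕ → ℝ) (j : ℕ) : ℝ :=
  sSup {v | ∃ l i, l < i ∧ i ≤ k ∧ index m g (p i) = j ∧ index m g (p l) = j ∧
    v = slope N m g k p l i}

/-- `X_j^max`. -/
def xMax (N m : ℕ) (g : ℕ → ℝ → ℝ) (k : ℕ) (p : ℕ → ℝ) (j : ℕ) : ℝ :=
  sSup {v | ∃ i, 1 ≤ i ∧ i ≤ k ∧ max (index m g (p i)) (index m g (p (i - 1))) = j ∧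
    v = hlen N (p (i - 1)) (p i)}

/-- `c_i`. -/
def cEst (N m : ℕ) (g : ℕ → ℝ → ℝ) (k : ℕ) (p : ℕ → ℝ) (i : ℕ) : ℝ :=
  if index m g (p i) = index m g (p (i - 1)) then slope N m g k p (i - 1) i else 0

/-- `l_i`. -/
def lEst (N m : ℕ) (g : ℕ → ℝ → ℝ) (k : ℕ) (p : ℕ → ℝ) (i : ℕ) : ℝ :=
  if 2 ≤ i ∧ index m g (p (i - 2)) = index m g (p (i - 1)) ∧
      index m g (p i) ≤ index m g (p (i - 1)) then
    slope N m g k p (i - 2) (i - 1) else 0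

/-- `r_i`. -/
def rEst (N m : ℕ) (g : ℕ → ℝ → ℝ) (k : ℕ) (p : ℕ → ℝ) (i : ℕ) : ℝ :=
  if i + 1 ≤ k ∧ index m g (p (i + 1)) = index m g (p i) ∧
      index m g (p (i - 1)) ≤ index m g (p i) then
    slope N m g k p i (i + 1) else 0

/-- `λ_i = max {l_i, c_i, r_i}`. -/
def lambdaEst (N m : ℕ) (g : ℕ → ℝ → ℝ) (k : ℕ) (p : ℕ → ℝ) (i : ℕ) : ℝ :=
  max (lEst N m g k p i) (max (cEst N m g k p i) (rEst N m g k p i))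

/-- `γ_i = μ_j (x_i - x_{i-1})^(1/N) / X_j^max` with `j = max {ν_i, ν_{i-1}}`. -/
def gammaEst (N m : ℕ) (g : ℕ → ℝ → ℝ) (k : ℕ) (p : ℕ → ℝ) (i : ℕ) : ℝ :=
  muBound N m g k p (max (index m g (p i)) (index m g (p (i - 1)))) * hlen N (p (i - 1)) (p i) /
    xMax N m g k p (max (index m g (p i)) (index m g (p (i - 1))))

/-- `M_i = max {λ_i, γ_i, ξ}`. -/
def MEst (N m : ℕ) (g : ℕ → ℝ → ℝ) (ξ : ℝ) (k : ℕ) (p : ℕ → ℝ) (i : ℕ) : ℝ :=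
  max (lambdaEst N m g k p i) (max (gammaEst N m g k p i) ξ)

/-- The characteristic `R_i` of the interval `[x_{i-1}, x_i]`. -/
def charR (N m : ℕ) (g : ℕ → ℝ → ℝ) (r ξ : ℝ) (k : ℕ) (p : ℕ → ℝ) (i : ℕ) : ℝ :=
  let Δ := hlen N (p (i - 1)) (p i)
  let rM := r * MEst N m g ξ k p i
  let z := zval m g k p i
  let z' := zval m g k p (i - 1)
  if index m g (p i) = index m g (p (i - 1)) then
    Δ + (z - z') ^ 2 / (rM ^ 2 * Δ) - 2 * (z + z') / rM
  else if index m g (p (i - 1)) < index m g (p i) then 2 * Δ - 4 * z / rM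
  else 2 * Δ - 4 * z' / rM

/-- `t`: the smallest number of an interval of maximal characteristic. -/
def chosen (N m : ℕ) (g : ℕ → ℝ → ℝ) (r ξ : ℝ) (k : ℕ) (p : ℕ → ℝ) : ℕ :=
  sInf {t | 1 ≤ t ∧ t ≤ k ∧
    ∀ i, 1 ≤ i → i ≤ k → charR N m g r ξ k p i ≤ charR N m g r ξ k p t}

/-- The next trial point `x^{k+1}`. -/
def newPoint (N m : ℕ) (g : ℕ → ℝ → ℝ) (r ξ : ℝ) (k : ℕ) (p : ℕ → ℝ) : ℝ :=
  let t := chosen N m g r ξ k p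
  let dz := zval m g k p t - zval m g k p (t - 1)
  if index m g (p t) = index m g (p (t - 1)) then
    (p t + p (t - 1)) / 2 - Real.sign dz * |dz| ^ N / (2 * r * MEst N m g ξ k p t ^ N)
  else (p t + p (t - 1)) / 2

/-! ### The infinite sequence of trial points -/

/-- The elements of a finite set in increasing order, numbered from `0`. -/
def sorted (S : Finset ℝ) (i : ℕ) : ℝ := (S.sort (· ≤ ·)).getD i 0

/-- The set `{x^0, …, x^k}` of the trial points of the first `k` iterations. -/
def trialSet (N m : ℕ) (g : ℕ → ℝ → ℝ) (r ξ : ℝ) : ℕ → Finset ℝ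
  | 0 => {0}
  | 1 => {0, 1}
  | k + 2 => insert
      (newPoint N m g r ξ (k + 1) (sorted (trialSet N m g r ξ (k + 1))))
      (trialSet N m g r ξ (k + 1))

/-- The renumbered points `x_0 < ⋯ < x_k` of the first `k` iterations. -/
def node (N m : ℕ) (g : ℕ → ℝ → ℝ) (r ξ : ℝ) (k : ℕ) : ℕ → ℝ :=
  sorted (trialSet N m g r ξ k)

/-- The trial points `x^0 = 0`, `x^1 = 1`, `x^2`, … generated by the algorithm. -/
def trial (N m : ℕ) (g : ℕ → ℝ → ℝ) (r ξ : ℝ) : ℕ → ℝ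
  | 0 => 0
  | 1 => 1
  | k + 2 => newPoint N m g r ξ (k + 1) (node N m g r ξ (k + 1))

/-! ### The convergence condition -/

/-- `C_j`, for a point `xs` in `[x_{j-1}, x_j]`. -/
def CVal (N m : ℕ) (g : ℕ → ℝ → ℝ) (k : ℕ) (p : ℕ → ℝ) (xs : ℝ) (j : ℕ) : ℝ :=
  if index m g (p j) < index m g (p (j - 1)) then
    zval m g k p (j - 1) / hlen N (p (j - 1)) xs
  else if index m g (p (j - 1)) = index m g (p j) then
    max (zval m g k p (j - 1) / hlen N (p (j - 1)) xs) (zval m g k p j / hlen N xs (p j))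
  else zval m g k p j / hlen N xs (p j)

/-- `D_j`. -/
def DVal (N m : ℕ) (g : ℕ → ℝ → ℝ) (k : ℕ) (p : ℕ → ℝ) (j : ℕ) : ℝ :=
  if index m g (p (j - 1)) = index m g (p j) then slope N m g k p (j - 1) j else 0

/-- The right-hand side of the convergence condition `r M_j > …`. -/
def threshold (N m : ℕ) (g : ℕ → ℝ → ℝ) (k : ℕ) (p : ℕ → ℝ) (xs : ℝ) (j : ℕ) : ℝ :=
  if index m g (p (j - 1)) = index m g (p j) then
    (2 : ℝ) ^ (1 - 1 / (N : ℝ)) * CVal N m g k p xs j +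
      √((2 : ℝ) ^ (2 - 2 / (N : ℝ)) * CVal N m g k p xs j ^ 2 - DVal N m g k p j ^ 2)
  else 2 * CVal N m g k p xs j

/-- The difference `r M_j - threshold` in the `k`-th iteration, the convergence condition for the
point `xs` and the interval `[x_{j-1}, x_j]` being that it is positive. -/
def gap (N m : ℕ) (g : ℕ → ℝ → ℝ) (r ξ : ℝ) (xs : ℝ) (k j : ℕ) : ℝ :=
  r * MEst N m g ξ k (node N m g r ξ k) j - threshold N m g k (node N m g r ξ k) xs j

end IndexMethod

end

/-! Geometry of the curve. Robustness puts a ball of the feasible region near `ys`, and curves of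
high level enter it, so the best value on the curve exceeds the global minimum by less than any
prescribed `ρ`. Compactness of the region and uniqueness of `ys` force feasible points with such
values into the `ε`-ball. Since `Phi` is positive at infeasible points and has minimum `0` over the
feasible ones, its minimisers are those of the reduced problem (`isSolution_iff`).

Convergence of the algorithm. At a fixed level the curve is Lipschitz, so all `MEst` stay below a
constant independent of the iteration (`MEst_le`). The threshold in the convergence condition is
tuned so that a gap of at least `δ` gives the interval containing the solution a characteristic of
at least a fixed multiple of its Hölder length (`le_charR`). Suppose only finitely many trials fall
near the solution inside `[a,b]`. Then that interval never shrinks below some `η`. As the gap is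
eventually positive and does not tend to `0`, its characteristic is infinitely often above a
positive constant. The chosen interval has at least this characteristic, and `charR_le` makes it
long; `newPoint_bounds` then places the new trial at a fixed distance from all old ones. In the
compact interval `[0,1]` this cannot happen infinitely often (`not_frequently_separated`). -/

namespace IndexMethod

/-! ### The Hölder length -/

lemma hlen_pos {N : ℕ} {a b : ℝ} (h : a < b) : 0 < hlen N a b :=
  Real.rpow_pos_of_pos (sub_pos.2 h) _

lemma hlen_nonneg {N : ℕ} {a b : ℝ} (h : a ≤ b) : 0 ≤ hlen N a b :=
  Real.rpow_nonneg (sub_nonneg.2 h) _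

lemma hlen_pow {N : ℕ} (hN : N ≠ 0) {a b : ℝ} (h : a ≤ b) : hlen N a b ^ N = b - a := by
  rw [hlen, one_div, Real.rpow_inv_natCast_pow (sub_nonneg.2 h) hN]

lemma hlen_le_hlen {N : ℕ} {a b c d : ℝ} (hab : a ≤ b) (h : b - a ≤ d - c) :
    hlen N a b ≤ hlen N c d :=
  Real.rpow_le_rpow (sub_nonneg.2 hab) h (by positivity)

lemma hlen_le_one {N : ℕ} {a b : ℝ} (h : a ≤ b) (h1 : b - a ≤ 1) : hlen N a b ≤ 1 :=
  Real.rpow_le_one (sub_nonneg.2 h) h1 (by positivity)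

/-- Raising a number of `(0,1]` to the exponent `1/N ≤ 1` does not decrease it. This turns Lipschitz
bounds on `[0,1]` into Hölder bounds with the same constant. -/
lemma sub_le_hlen {N : ℕ} (hN : N ≠ 0) {a b : ℝ} (h : a < b) (h1 : b - a ≤ 1) :
    b - a ≤ hlen N a b := by
  have hN1 : (1 : ℝ) ≤ N := by exact_mod_cast Nat.one_le_iff_ne_zero.2 hN
  have := Real.rpow_le_rpow_of_exponent_ge (sub_pos.2 h) h1 (y := 1) (z := 1 / (N : ℝ))
    (by rw [div_le_one (by positivity)]; exact hN1)
  simpa [hlen] using this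

/-- Power-mean inequality for `t ↦ t ^ N`; it is the source of the factor `2^(1 - 1/N)` in
`threshold`. -/
lemma hlen_add_hlen_le {N : ℕ} (hN : N ≠ 0) {a b c : ℝ} (hab : a ≤ b) (hbc : b ≤ c) :
    hlen N a b + hlen N b c ≤ (2 : ℝ) ^ (1 - 1 / (N : ℝ)) * hlen N a c := by
  have h0 := hlen_nonneg (N := N) hab
  have h0' := hlen_nonneg (N := N) hbc
  have h := add_pow_le h0 h0' N
  rw [hlen_pow hN hab, hlen_pow hN hbc] at h
  refine le_of_pow_le_pow_left₀ hN (by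
    have := hlen_nonneg (N := N) (hab.trans hbc); positivity) (h.trans_eq ?_)
  have hq : ((2 : ℝ) ^ (1 - 1 / (N : ℝ))) ^ N = 2 ^ (N - 1) := by
    rw [← Real.rpow_natCast, ← Real.rpow_mul (by norm_num), ← Real.rpow_natCast,
      Nat.cast_pred (Nat.pos_of_ne_zero hN)]
    congr 1
    field_simp
  rw [mul_pow, hlen_pow hN (hab.trans hbc), hq]
  ring

/-! ### The index scheme -/

section scheme

variable {m : ℕ} {g : ℕ → ℝ → ℝ}

/-- The feasible set of the reduced problem. -/
def feasible (m : ℕ) (g : ℕ → ℝ → ℝ) : Set ℝ :=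
  {x | x ∈ Icc (0 : ℝ) 1 ∧ ∀ l, 1 ≤ l → l < m + 1 → g l x ≤ 0}

/-- Each `g_i` is Lipschitz, with constant `H`, on the part of `[0,1]` where it is used. -/
def IndexLipschitz (m : ℕ) (g : ℕ → ℝ → ℝ) (H : ℝ) : Prop :=
  ∀ i, 1 ≤ i → i ≤ m + 1 → ∀ x ∈ Icc (0 : ℝ) 1, ∀ y ∈ Icc (0 : ℝ) 1,
    (∀ l, 1 ≤ l → l < i → g l x ≤ 0) → (∀ l, 1 ≤ l → l < i → g l y ≤ 0) →
    |g i x - g i y| ≤ H * |x - y|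

lemma index_mem (x : ℝ) :
    1 ≤ index m g x ∧ (index m g x = m + 1 ∨ 0 < g (index m g x) x) :=
  Nat.sInf_mem (s := {i | 1 ≤ i ∧ (i = m + 1 ∨ 0 < g i x)}) ⟨m + 1, by simp⟩

lemma index_le (x : ℝ) : index m g x ≤ m + 1 :=
  Nat.sInf_le (by simp)

lemma nonpos_of_lt_index {x : ℝ} {l : ℕ} (hl : 1 ≤ l) (h : l < index m g x) : g l x ≤ 0 := by
  by_contra! hc
  exact absurd (Nat.sInf_le (s := {i | 1 ≤ i ∧ (i = m + 1 ∨ 0 < g i x)}) ⟨hl, Or.inr hc⟩)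
    (not_le.2 h)

lemma pos_of_index_ne {x : ℝ} (h : index m g x ≠ m + 1) : 0 < g (index m g x) x :=
  (index_mem x).2.resolve_left h

lemma index_eq_iff {x : ℝ} :
    index m g x = m + 1 ↔ ∀ l, 1 ≤ l → l < m + 1 → g l x ≤ 0 := by
  refine ⟨fun h l hl hlm => nonpos_of_lt_index hl (h ▸ hlm), fun h => ?_⟩
  by_contra hc
  exact absurd (h _ (index_mem x).1 (lt_of_le_of_ne (index_le x) hc))
    (not_le.2 (pos_of_index_ne hc))

lemma mem_feasible_iff {x : ℝ} (hx : x ∈ Icc (0 : ℝ) 1) :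
    x ∈ feasible m g ↔ index m g x = m + 1 :=
  ⟨fun h => index_eq_iff.2 h.2, fun h => ⟨hx, index_eq_iff.1 h⟩⟩

/-- If the reduced problem has a minimiser, the solutions of the unconstrained problem for `Φ`
are exactly the minimisers of the reduced problem. -/
lemma isSolution_iff {x₀ : ℝ} (h₀ : x₀ ∈ feasible m g)
    (hmin : ∀ y ∈ feasible m g, g (m + 1) x₀ ≤ g (m + 1) y) (x : ℝ) :
    IsSolution m g x ↔
      x ∈ feasible m g ∧ ∀ y ∈ feasible m g, g (m + 1) x ≤ g (m + 1) y := by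
  have hopt : optValue m g = g (m + 1) x₀ :=
    IsLeast.csInf_eq ⟨mem_image_of_mem _ h₀, by rintro _ ⟨y, hy, rfl⟩; exact hmin y hy⟩
  have hPhi : ∀ y ∈ feasible m g, Phi m g y = g (m + 1) y - g (m + 1) x₀ := by
    intro y hy
    have := (mem_feasible_iff hy.1).1 hy
    simp [Phi, this, hopt]
  -- An index below `m + 1` means a violated constraint, whose value is positive and is not shifted
  -- by `optValue`.
  have hPhi' : ∀ y, index m g y ≠ m + 1 → 0 < Phi m g y := by
    intro y hy
    simpa [Phi, hy] using pos_of_index_ne hy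
  constructor
  · rintro ⟨hx, hs⟩
    have h1 := hs x₀ h₀.1
    rw [hPhi x₀ h₀, sub_self] at h1
    have hf : x ∈ feasible m g := by
      rw [mem_feasible_iff hx]
      by_contra hc
      exact absurd h1 (not_le.2 (hPhi' x hc))
    refine ⟨hf, fun y hy => ?_⟩
    rw [hPhi x hf] at h1
    linarith [hmin y hy]
  · rintro ⟨hf, hs⟩
    refine ⟨hf.1, fun y hy => ?_⟩
    rw [hPhi x hf]
    by_cases hc : index m g y = m + 1
    · have hyf := (mem_feasible_iff hy).2 hc
      rw [hPhi y hyf]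
      linarith [hs y hyf]
    · linarith [hPhi' y hc, hs x₀ h₀]

end scheme

/-! ### One iteration -/

/-- `p 0 < ⋯ < p k` are points of `[0,1]`. -/
structure IsPartition (k : ℕ) (p : ℕ → ℝ) : Prop where
  mem : ∀ i, i ≤ k → p i ∈ Icc (0 : ℝ) 1
  lt : ∀ l i, l < i → i ≤ k → p l < p i

section step

variable {N m k : ℕ} {g : ℕ → ℝ → ℝ} {p : ℕ → ℝ} {H r ξ : ℝ}

lemma IsPartition.sub_le_one (hp : IsPartition k p) {l i : ℕ} (hl : l ≤ k) (hi : i ≤ k) :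
    p i - p l ≤ 1 := by
  linarith [(hp.mem i hi).2, (hp.mem l hl).1]

lemma IsPartition.pred_lt (hp : IsPartition k p) {i : ℕ} (h1 : 1 ≤ i) (hi : i ≤ k) :
    p (i - 1) < p i := hp.lt _ _ (by omega) hi

lemma finite_feasibleValues :
    {v | ∃ i, i ≤ k ∧ index m g (p i) = m + 1 ∧ v = g (m + 1) (p i)}.Finite := by
  refine ((Set.finite_Iic k).image fun i => g (m + 1) (p i)).subset ?_
  rintro v ⟨i, hi, -, rfl⟩
  exact ⟨i, hi, rfl⟩

lemma bestValue_le {i : ℕ} (hi : i ≤ k) (h : index m g (p i) = m + 1) :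
    bestValue m g k p ≤ g (m + 1) (p i) :=
  csInf_le finite_feasibleValues.bddBelow ⟨i, hi, h, rfl⟩

/-- At index `m + 1` the subtracted `bestValue` is a minimum over the same trial points; at any
other index the value is that of a violated constraint. -/
lemma zval_nonneg {i : ℕ} (hi : i ≤ k) : 0 ≤ zval m g k p i := by
  unfold zval
  split_ifs with h
  · rw [h]; linarith [bestValue_le hi h]
  · linarith [pos_of_index_ne h]

/-- The value at a solution that is a trial point is zero. -/
lemma zval_eq_zero (hp : IsPartition k p) {i : ℕ} (hi : i ≤ k)
    (hf : p i ∈ feasible m g) (hs : ∀ y ∈ feasible m g, g (m + 1) (p i) ≤ g (m + 1) y) :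
    zval m g k p i = 0 := by
  have h := (mem_feasible_iff (hp.mem i hi)).1 hf
  have : bestValue m g k p = g (m + 1) (p i) := by
    refine IsLeast.csInf_eq ⟨⟨i, hi, h, rfl⟩, ?_⟩
    rintro _ ⟨l, hl, hl', rfl⟩
    exact hs _ ((mem_feasible_iff (hp.mem l hl)).2 hl')
  simp [zval, h, this]

/-! ### Bounds for the estimated Hölder constants -/

lemma slope_nonneg (hp : IsPartition k p) {l i : ℕ} (hl : l < i) (hi : i ≤ k) :
    0 ≤ slope N m g k p l i :=
  div_nonneg (abs_nonneg _) (hlen_pos (hp.lt l i hl hi)).le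

/-- For equal indices the shift by `bestValue` cancels, and both points satisfy all constraints
before their common index, so the Lipschitz bound of that function applies. -/
lemma slope_le (hN : N ≠ 0) (hp : IsPartition k p) (hH : 0 ≤ H) (hg : IndexLipschitz m g H)
    {l i : ℕ} (hl : l < i) (hi : i ≤ k) (h : index m g (p l) = index m g (p i)) :
    slope N m g k p l i ≤ H := by
  have hlt := hp.lt l i hl hi
  have hlk : l ≤ k := by omega
  rw [slope, div_le_iff₀ (hlen_pos hlt)]
  have h1 : zval m g k p i - zval m g k p l =
      g (index m g (p i)) (p i) - g (index m g (p i)) (p l) := by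
    simp only [zval, h]; ring
  rw [h1]
  refine (hg _ (index_mem _).1 (index_le _) _ (hp.mem i hi) _ (hp.mem l hlk)
    (fun _ h1 h2 => nonpos_of_lt_index h1 h2)
    (fun _ h1 h2 => nonpos_of_lt_index h1 (h ▸ h2))).trans ?_
  rw [abs_of_pos (sub_pos.2 hlt)]
  exact mul_le_mul_of_nonneg_left (sub_le_hlen hN hlt (hp.sub_le_one hlk hi)) hH

lemma muBound_le (hN : N ≠ 0) (hp : IsPartition k p) (hH : 0 ≤ H) (hg : IndexLipschitz m g H)
    (j : ℕ) : muBound N m g k p j ≤ H := by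
  refine Real.sSup_le ?_ hH
  rintro _ ⟨l, i, hl, hi, h1, h2, rfl⟩
  exact slope_le hN hp hH hg hl hi (h2.trans h1.symm)

lemma hlen_le_xMax (hp : IsPartition k p) {i : ℕ} (h1 : 1 ≤ i) (hi : i ≤ k) :
    hlen N (p (i - 1)) (p i) ≤
      xMax N m g k p (max (index m g (p i)) (index m g (p (i - 1)))) := by
  refine le_csSup ⟨1, ?_⟩ ⟨i, h1, hi, rfl, rfl⟩
  rintro _ ⟨l, hl, hlk, -, rfl⟩
  exact hlen_le_one (hp.pred_lt hl hlk).le (hp.sub_le_one (by omega) hlk)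

lemma gammaEst_le (hN : N ≠ 0) (hp : IsPartition k p) (hH : 0 ≤ H) (hg : IndexLipschitz m g H)
    {i : ℕ} (h1 : 1 ≤ i) (hi : i ≤ k) : gammaEst N m g k p i ≤ H := by
  have hpos := hlen_pos (N := N) (hp.pred_lt h1 hi)
  have hx := hlen_le_xMax (N := N) (m := m) (g := g) hp h1 hi
  rw [gammaEst, div_le_iff₀ (hpos.trans_le hx)]
  exact mul_le_mul (muBound_le hN hp hH hg _) hx hpos.le hH

lemma lambdaEst_le (hN : N ≠ 0) (hp : IsPartition k p) (hH : 0 ≤ H) (hg : IndexLipschitz m g H)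
    {i : ℕ} (h1 : 1 ≤ i) (hi : i ≤ k) : lambdaEst N m g k p i ≤ H := by
  refine max_le ?_ (max_le ?_ ?_)
  · unfold lEst
    split_ifs with h
    · exact slope_le hN hp hH hg (by omega) (by omega) h.2.1
    · exact hH
  · unfold cEst
    split_ifs with h
    · exact slope_le hN hp hH hg (by omega) hi h.symm
    · exact hH
  · unfold rEst
    split_ifs with h
    · exact slope_le hN hp hH hg (by omega) h.1 h.2.1.symm
    · exact hH

/-- The bound does not depend on the iteration, so a gap `δ` relative to `r * MEst` is worth a fixed
fraction. -/
lemma MEst_le (hN : N ≠ 0) (hp : IsPartition k p) (hH : 0 ≤ H) (hg : IndexLipschitz m g H)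
    {i : ℕ} (h1 : 1 ≤ i) (hi : i ≤ k) : MEst N m g ξ k p i ≤ max H ξ :=
  max_le ((lambdaEst_le hN hp hH hg h1 hi).trans (le_max_left _ _))
    (max_le_max (gammaEst_le hN hp hH hg h1 hi) le_rfl)

lemma le_MEst (i : ℕ) : ξ ≤ MEst N m g ξ k p i :=
  (le_max_right _ _).trans (le_max_right _ _)

lemma abs_sub_le_MEst_mul (hp : IsPartition k p) {i : ℕ} (h1 : 1 ≤ i) (hi : i ≤ k)
    (h : index m g (p i) = index m g (p (i - 1))) :
    |zval m g k p i - zval m g k p (i - 1)| ≤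
      MEst N m g ξ k p i * hlen N (p (i - 1)) (p i) := by
  rw [← div_le_iff₀ (hlen_pos (hp.pred_lt h1 hi))]
  have : cEst N m g k p i = slope N m g k p (i - 1) i := if_pos h
  exact this.symm.le.trans
    (((le_max_left _ _).trans (le_max_right _ _)).trans (le_max_left _ _))

/-- Characteristics are at most twice the Hölder length of the interval. -/
lemma charR_le (hp : IsPartition k p) (hr : 1 < r) (hξ : 0 < ξ) {i : ℕ} (h1 : 1 ≤ i)
    (hi : i ≤ k) : charR N m g r ξ k p i ≤ 2 * hlen N (p (i - 1)) (p i) := by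
  have hΔ := hlen_pos (N := N) (hp.pred_lt h1 hi)
  have hM : 0 < MEst N m g ξ k p i := hξ.trans_le (le_MEst i)
  have hz := zval_nonneg (m := m) (g := g) (p := p) hi
  have hz' := zval_nonneg (m := m) (g := g) (p := p) (i := i - 1) (k := k) (by omega)
  have hr0 : 0 < r := by linarith
  simp only [charR]
  split_ifs with h h'
  · have hd := abs_sub_le_MEst_mul (N := N) (ξ := ξ) hp h1 hi h
    -- As `|z - z'| ≤ M Δ ≤ r M Δ`, the quadratic term contributes at most `Δ`; the remaining term
    -- only lowers the characteristic.
    have hd2 : (zval m g k p i - zval m g k p (i - 1)) ^ 2 ≤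
        (r * MEst N m g ξ k p i) ^ 2 * hlen N (p (i - 1)) (p i) *
          hlen N (p (i - 1)) (p i) := by
      have : |zval m g k p i - zval m g k p (i - 1)| ≤
          r * MEst N m g ξ k p i * hlen N (p (i - 1)) (p i) := by
        refine hd.trans (mul_le_mul_of_nonneg_right ?_ hΔ.le)
        nlinarith
      have := pow_le_pow_left₀ (abs_nonneg _) this 2
      rw [sq_abs] at this
      linarith
    have h3 : (zval m g k p i - zval m g k p (i - 1)) ^ 2 /
        ((r * MEst N m g ξ k p i) ^ 2 * hlen N (p (i - 1)) (p i)) ≤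
          hlen N (p (i - 1)) (p i) := by
      rw [div_le_iff₀ (by positivity)]; linarith
    have h4 : 0 ≤ 2 * (zval m g k p i + zval m g k p (i - 1)) /
        (r * MEst N m g ξ k p i) := by positivity
    linarith
  · have : 0 ≤ 4 * zval m g k p i / (r * MEst N m g ξ k p i) := by positivity
    linarith
  · have : 0 ≤ 4 * zval m g k p (i - 1) / (r * MEst N m g ξ k p i) := by positivity
    linarith

/-- A lower bound for the characteristic of an interval containing a solution. -/
lemma le_charR (hN : N ≠ 0) (hp : IsPartition k p) (hH : 0 ≤ H) (hg : IndexLipschitz m g H)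
    (hr : 1 < r) (hξ : 0 < ξ) {xs : ℝ} (hf : xs ∈ feasible m g)
    (hs : ∀ y ∈ feasible m g, g (m + 1) xs ≤ g (m + 1) y) {i : ℕ} (h1 : 1 ≤ i) (hi : i ≤ k)
    (hx : xs ∈ Icc (p (i - 1)) (p i)) {δ : ℝ} (hδ : 0 < δ)
    (hgap : δ ≤ r * MEst N m g ξ k p i - threshold N m g k p xs i) :
    hlen N (p (i - 1)) (p i) *
      min ((δ / (r * max H ξ)) ^ 2) (2 * (δ / (r * max H ξ))) ≤ charR N m g r ξ k p i := by
  have hik : i - 1 ≤ k := by omega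
  have hΔ := hlen_pos (N := N) (hp.pred_lt h1 hi)
  have hM : 0 < MEst N m g ξ k p i := hξ.trans_le (le_MEst i)
  have hr0 : 0 < r := by linarith
  have hrM : 0 < r * MEst N m g ξ k p i := by positivity
  have hz := zval_nonneg (m := m) (g := g) (p := p) hi
  have hz' := zval_nonneg (m := m) (g := g) (p := p) hik
  have hβ := hlen_nonneg (N := N) hx.1
  have hα := hlen_nonneg (N := N) hx.2
  have hβΔ : hlen N (p (i - 1)) xs ≤ hlen N (p (i - 1)) (p i) :=
    hlen_le_hlen hx.1 (by linarith [hx.2])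
  have hαΔ : hlen N xs (p i) ≤ hlen N (p (i - 1)) (p i) :=
    hlen_le_hlen hx.2 (by linarith [hx.1])
  -- If the solution is the endpoint itself, the quotient has denominator `0` and Lean reads it as
  -- `0`; the identity survives because the value at a solution vanishes.
  have hzl : zval m g k p (i - 1) / hlen N (p (i - 1)) xs * hlen N (p (i - 1)) xs =
      zval m g k p (i - 1) := by
    rcases hx.1.eq_or_lt with h | h
    · rw [zval_eq_zero hp hik (h ▸ hf) (by rw [h]; exact hs)]; simp
    · exact div_mul_cancel₀ _ (hlen_pos h).ne'
  have hzr : zval m g k p i / hlen N xs (p i) * hlen N xs (p i) = zval m g k p i := by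
    rcases hx.2.eq_or_lt with h | h
    · rw [zval_eq_zero hp hi (h ▸ hf) (by rw [← h]; exact hs)]; simp
    · exact div_mul_cancel₀ _ (hlen_pos h).ne'
  have hratio : δ / (r * max H ξ) ≤ δ / (r * MEst N m g ξ k p i) :=
    div_le_div_of_nonneg_left hδ.le hrM
      (mul_le_mul_of_nonneg_left (MEst_le hN hp hH hg h1 hi) hr0.le)
  have hB : 0 < r * max H ξ := mul_pos hr0 (hξ.trans_le (le_max_right _ _))
  -- the cases of different indices
  have key : ∀ z C β : ℝ, 0 ≤ C → C * β = z → β ≤ hlen N (p (i - 1)) (p i) →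
      δ ≤ r * MEst N m g ξ k p i - 2 * C →
      hlen N (p (i - 1)) (p i) *
        min ((δ / (r * max H ξ)) ^ 2) (2 * (δ / (r * max H ξ))) ≤
      2 * hlen N (p (i - 1)) (p i) - 4 * z / (r * MEst N m g ξ k p i) := by
    intro z C β hC hCz hβ hd
    have hzC : z ≤ C * hlen N (p (i - 1)) (p i) :=
      hCz ▸ mul_le_mul_of_nonneg_left hβ hC
    calc _ ≤ hlen N (p (i - 1)) (p i) * (2 * (δ / (r * MEst N m g ξ k p i))) :=
          mul_le_mul_of_nonneg_left ((min_le_right _ _).trans (by linarith)) hΔ.le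
      _ ≤ _ := by
          have e : 2 * hlen N (p (i - 1)) (p i) - 4 * z / (r * MEst N m g ξ k p i) -
              hlen N (p (i - 1)) (p i) * (2 * (δ / (r * MEst N m g ξ k p i))) =
              (2 * hlen N (p (i - 1)) (p i) * (r * MEst N m g ξ k p i - δ) - 4 * z) /
                (r * MEst N m g ξ k p i) := by
            field_simp
            ring
          have : 0 ≤ (2 * hlen N (p (i - 1)) (p i) * (r * MEst N m g ξ k p i - δ) - 4 * z) /
                (r * MEst N m g ξ k p i) := by
            refine div_nonneg ?_ hrM.le
            nlinarith
          linarith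
  simp only [charR]
  rcases lt_trichotomy (index m g (p (i - 1))) (index m g (p i)) with h | h | h
  · rw [if_neg h.ne', if_pos h]
    rw [threshold, if_neg h.ne, CVal, if_neg h.not_gt, if_neg h.ne] at hgap
    exact key _ _ _ (div_nonneg hz hα) hzr hαΔ hgap
  · rw [if_pos h.symm]
    rw [threshold, if_pos h, CVal, if_neg h.not_gt, if_pos h, DVal, if_pos h] at hgap
    set C := max (zval m g k p (i - 1) / hlen N (p (i - 1)) xs)
      (zval m g k p i / hlen N xs (p i)) with hCdef
    set q : ℝ := (2 : ℝ) ^ (1 - 1 / (N : ℝ)) with hq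
    have hq2 : (2 : ℝ) ^ (2 - 2 / (N : ℝ)) = q ^ 2 := by
      rw [hq, ← Real.rpow_natCast, ← Real.rpow_mul (by norm_num)]
      congr 1; push_cast; ring
    rw [hq2] at hgap
    have hC : 0 ≤ C := (div_nonneg hz' hβ).trans (le_max_left _ _)
    -- `C` dominates both quotients, so each value is at most `C` times the Hölder distance of its
    -- endpoint to the solution.
    have hsum : zval m g k p i + zval m g k p (i - 1) ≤
        C * (q * hlen N (p (i - 1)) (p i)) := by
      calc _ ≤ C * hlen N xs (p i) + C * hlen N (p (i - 1)) xs :=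
            add_le_add
              (hzr.symm.le.trans (mul_le_mul_of_nonneg_right (le_max_right _ _) hα))
              (hzl.symm.le.trans (mul_le_mul_of_nonneg_right (le_max_left _ _) hβ))
        _ = C * (hlen N (p (i - 1)) xs + hlen N xs (p i)) := by ring
        _ ≤ _ := mul_le_mul_of_nonneg_left (hlen_add_hlen_le hN hx.1 hx.2) hC
    set D := slope N m g k p (i - 1) i with hD
    have hdz : (zval m g k p i - zval m g k p (i - 1)) ^ 2 =
        D ^ 2 * hlen N (p (i - 1)) (p i) ^ 2 := by
      rw [← sq_abs, ← mul_pow, hD, slope, div_mul_cancel₀ _ hΔ.ne']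
    set s := √(q ^ 2 * C ^ 2 - D ^ 2) with hs_def
    have hs0 : 0 ≤ s := Real.sqrt_nonneg _
    -- Only an inequality: for a negative radicand the square root is `0`.
    have hs2 : q ^ 2 * C ^ 2 - D ^ 2 ≤ s ^ 2 := by
      rcases le_total 0 (q ^ 2 * C ^ 2 - D ^ 2) with h0 | h0
      · rw [hs_def, Real.sq_sqrt h0]
      · exact h0.trans (sq_nonneg _)
    set Δ := hlen N (p (i - 1)) (p i)
    set R := r * MEst N m g ξ k p i
    -- For a nonnegative radicand, `q * C + s` is the larger root of the quadratic in `R`. In either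
    -- case, exceeding it by `δ` gives `(R - q C)² ≥ (s + δ)² ≥ s² + δ²`.
    have hquad : δ ^ 2 ≤ R ^ 2 - 2 * (q * C) * R + D ^ 2 := by
      have : (s + δ) ^ 2 ≤ (R - q * C) ^ 2 :=
        pow_le_pow_left₀ (by positivity) (by linarith) 2
      nlinarith [mul_nonneg hs0 hδ.le]
    calc _ ≤ Δ * (δ / R) ^ 2 := by
          refine mul_le_mul_of_nonneg_left ((min_le_left _ _).trans ?_) hΔ.le
          exact pow_le_pow_left₀ (by positivity) hratio 2
      _ ≤ _ := by
          rw [hdz]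
          have e : Δ + D ^ 2 * Δ ^ 2 / (R ^ 2 * Δ) -
              2 * (zval m g k p i + zval m g k p (i - 1)) / R - Δ * (δ / R) ^ 2 =
              (Δ * (R ^ 2 + D ^ 2 - δ ^ 2) -
                2 * (zval m g k p i + zval m g k p (i - 1)) * R) / R ^ 2 := by
            field_simp
            ring
          have : 0 ≤ (Δ * (R ^ 2 + D ^ 2 - δ ^ 2) -
                2 * (zval m g k p i + zval m g k p (i - 1)) * R) / R ^ 2 := by
            refine div_nonneg ?_ (by positivity)
            have h5 := mul_le_mul_of_nonneg_right hsum hrM.le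
            have h6 := mul_le_mul_of_nonneg_left hquad hΔ.le
            nlinarith
          linarith
  · rw [if_neg h.ne, if_neg h.not_gt]
    rw [threshold, if_neg h.ne', CVal, if_pos h] at hgap
    exact key _ _ _ (div_nonneg hz' hβ) hzl hβΔ hgap

lemma chosen_spec (hk : 1 ≤ k) :
    1 ≤ chosen N m g r ξ k p ∧ chosen N m g r ξ k p ≤ k ∧
      ∀ i, 1 ≤ i → i ≤ k →
        charR N m g r ξ k p i ≤ charR N m g r ξ k p (chosen N m g r ξ k p) := by
  refine Nat.sInf_mem (s := {t | 1 ≤ t ∧ t ≤ k ∧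
    ∀ i, 1 ≤ i → i ≤ k → charR N m g r ξ k p i ≤ charR N m g r ξ k p t}) ?_
  obtain ⟨t, ht, hmax⟩ := Finset.exists_max_image (Finset.Icc 1 k) (charR N m g r ξ k p)
    ⟨1, by simpa using hk⟩
  rw [Finset.mem_Icc] at ht
  exact ⟨t, ht.1, ht.2, fun i h1 h2 => hmax i (Finset.mem_Icc.2 ⟨h1, h2⟩)⟩

/-- The new point divides the chosen interval in a ratio bounded away from `0` and `1`. -/
lemma newPoint_bounds (hN : N ≠ 0) (hp : IsPartition k p) (hr : 1 < r) (hξ : 0 < ξ)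
    (hk : 1 ≤ k) :
    p (chosen N m g r ξ k p - 1) +
        (1 - 1 / r) / 2 * (p (chosen N m g r ξ k p) - p (chosen N m g r ξ k p - 1)) ≤
      newPoint N m g r ξ k p ∧
    newPoint N m g r ξ k p ≤ p (chosen N m g r ξ k p) -
        (1 - 1 / r) / 2 * (p (chosen N m g r ξ k p) - p (chosen N m g r ξ k p - 1)) := by
  obtain ⟨h1, hi, -⟩ := chosen_spec (N := N) (m := m) (g := g) (r := r) (ξ := ξ) (p := p) hk
  simp only [newPoint]
  set t := chosen N m g r ξ k p
  have hlt := hp.pred_lt h1 hi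
  have hr0 : 0 < r := by linarith
  have hM : 0 < MEst N m g ξ k p t := hξ.trans_le (le_MEst t)
  have hoff : 0 ≤ 1 / r * (p t - p (t - 1)) := mul_nonneg (by positivity) (by linarith)
  split_ifs with h
  · have hd := pow_le_pow_left₀ (abs_nonneg _)
      (abs_sub_le_MEst_mul (N := N) (ξ := ξ) hp h1 hi h) N
    rw [mul_pow, hlen_pow hN hlt.le] at hd
    set dz := zval m g k p t - zval m g k p (t - 1)
    have hsign : |Real.sign dz| ≤ 1 := by
      rcases Real.sign_apply_eq dz with h | h | h <;> simp [h]
    -- From `|dz| ≤ M Δ` and `Δ ^ N = p t - p (t - 1)`: the shift off the midpoint is at most `1 /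
    -- r` of the half-length.
    have hb : |Real.sign dz * |dz| ^ N / (2 * r * MEst N m g ξ k p t ^ N)| ≤
        1 / r * (p t - p (t - 1)) / 2 := by
      rw [abs_div, abs_mul, abs_pow, abs_abs,
        abs_of_pos (show 0 < 2 * r * MEst N m g ξ k p t ^ N by positivity),
        div_le_iff₀ (by positivity)]
      calc |Real.sign dz| * |dz| ^ N ≤ 1 * |dz| ^ N :=
            mul_le_mul_of_nonneg_right hsign (by positivity)
        _ ≤ MEst N m g ξ k p t ^ N * (p t - p (t - 1)) := by linarith
        _ = _ := by field_simp
    obtain ⟨hb1, hb2⟩ := abs_le.1 hb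
    constructor <;> linarith
  · constructor <;> linarith

end step

/-! ### The sequence of trial points -/

lemma sorted_eq_getElem {S : Finset ℝ} {i : ℕ} (h : i < S.card) :
    sorted S i = (S.sort (· ≤ ·))[i]'(by rwa [Finset.length_sort]) :=
  List.getD_eq_getElem _ _ _

lemma sorted_mem {S : Finset ℝ} {i : ℕ} (h : i < S.card) : sorted S i ∈ S := by
  rw [sorted_eq_getElem h, ← Finset.mem_sort (· ≤ ·)]
  exact List.getElem_mem _

lemma sorted_lt {S : Finset ℝ} {l i : ℕ} (hl : l < i) (h : i < S.card) :
    sorted S l < sorted S i := by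
  rw [sorted_eq_getElem h, sorted_eq_getElem (hl.trans h)]
  exact (S.sortedLT_sort).strictMono_get (a := ⟨l, by rw [Finset.length_sort]; omega⟩)
    (b := ⟨i, by rwa [Finset.length_sort]⟩) hl

lemma exists_sorted_eq {S : Finset ℝ} {x : ℝ} (h : x ∈ S) : ∃ i < S.card, sorted S i = x := by
  rw [← Finset.mem_sort (· ≤ ·)] at h
  obtain ⟨i, hi, rfl⟩ := List.getElem_of_mem h
  have hi' : i < S.card := by rwa [Finset.length_sort] at hi
  exact ⟨i, hi', sorted_eq_getElem hi'⟩

section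

variable {N m : ℕ} {g : ℕ → ℝ → ℝ} {r ξ : ℝ}

lemma isPartition_sorted {S : Finset ℝ} {k : ℕ} (hS : S.card = k + 1)
    (h01 : ∀ x ∈ S, x ∈ Icc (0 : ℝ) 1) : IsPartition k (sorted S) where
  mem i hi := h01 _ (sorted_mem (by omega))
  lt l i hl hi := sorted_lt hl (by omega)

/-- The new point is separated from the old ones, in proportion to the chosen interval. -/
lemma le_abs_newPoint_sub (hN : N ≠ 0) (hr : 1 < r) (hξ : 0 < ξ) {S : Finset ℝ} {k : ℕ}
    (hk : 1 ≤ k) (hS : S.card = k + 1) (h01 : ∀ x ∈ S, x ∈ Icc (0 : ℝ) 1) {x : ℝ}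
    (hx : x ∈ S) :
    (1 - 1 / r) / 2 * (sorted S (chosen N m g r ξ k (sorted S)) -
      sorted S (chosen N m g r ξ k (sorted S) - 1)) ≤
      |newPoint N m g r ξ k (sorted S) - x| := by
  have hp := isPartition_sorted hS h01
  obtain ⟨hb1, hb2⟩ := newPoint_bounds (m := m) (g := g) hN hp hr hξ hk
  obtain ⟨h1, hi, -⟩ := chosen_spec (N := N) (m := m) (g := g) (r := r) (ξ := ξ)
    (p := sorted S) hk
  set t := chosen N m g r ξ k (sorted S)
  obtain ⟨i, hik, rfl⟩ := exists_sorted_eq hx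
  rw [le_abs]
  rcases Nat.lt_or_ge i t with h | h
  · left
    have : sorted S i ≤ sorted S (t - 1) := by
      rcases (Nat.le_sub_one_of_lt h).eq_or_lt with h' | h'
      · rw [h']
      · exact (sorted_lt h' (by omega)).le
    linarith
  · right
    have : sorted S t ≤ sorted S i := by
      rcases h.eq_or_lt with h' | h'
      · rw [h']
      · exact (sorted_lt h' hik).le
    linarith

lemma newPoint_mem (hN : N ≠ 0) (hr : 1 < r) (hξ : 0 < ξ) {k : ℕ} {p : ℕ → ℝ} (hk : 1 ≤ k)
    (hp : IsPartition k p) : newPoint N m g r ξ k p ∈ Icc (0 : ℝ) 1 := by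
  obtain ⟨hb1, hb2⟩ := newPoint_bounds (m := m) (g := g) hN hp hr hξ hk
  obtain ⟨h1, hi, -⟩ := chosen_spec (N := N) (m := m) (g := g) (r := r) (ξ := ξ) (p := p) hk
  set t := chosen N m g r ξ k p
  have hlt := hp.pred_lt h1 hi
  have hc : 0 ≤ (1 - 1 / r) / 2 * (p t - p (t - 1)) := by
    have : 1 / r ≤ 1 := by rw [div_le_one (by linarith)]; exact hr.le
    exact mul_nonneg (by linarith) (by linarith)
  exact ⟨by linarith [(hp.mem (t - 1) (by omega)).1], by linarith [(hp.mem t hi).2]⟩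

lemma trialSet_succ {k : ℕ} (hk : 1 ≤ k) :
    trialSet N m g r ξ (k + 1) =
      insert (trial N m g r ξ (k + 1)) (trialSet N m g r ξ k) := by
  obtain ⟨k, rfl⟩ := Nat.exists_eq_add_of_le' hk
  rfl

lemma trial_succ {k : ℕ} (hk : 1 ≤ k) :
    trial N m g r ξ (k + 1) = newPoint N m g r ξ k (sorted (trialSet N m g r ξ k)) := by
  obtain ⟨k, rfl⟩ := Nat.exists_eq_add_of_le' hk
  rfl

/-- No trial point repeats, being at positive distance from its predecessors. Hence `sorted` never
returns its default `0` at positions up to `k`. -/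
lemma trialSet_card_and_mem (hN : N ≠ 0) (hr : 1 < r) (hξ : 0 < ξ) {k : ℕ} (hk : 1 ≤ k) :
    (trialSet N m g r ξ k).card = k + 1 ∧
      ∀ x ∈ trialSet N m g r ξ k, x ∈ Icc (0 : ℝ) 1 := by
  induction k, hk using Nat.le_induction with
  | base =>
    refine ⟨by simp [trialSet], fun x hx => ?_⟩
    simp only [trialSet, Finset.mem_insert, Finset.mem_singleton] at hx
    rcases hx with rfl | rfl <;> simp
  | succ k hk ih =>
    have hp := isPartition_sorted ih.1 ih.2
    rw [trialSet_succ hk, trial_succ hk]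
    refine ⟨?_, ?_⟩
    · rw [Finset.card_insert_of_notMem, ih.1]
      intro hmem
      have h := le_abs_newPoint_sub (m := m) (g := g) hN hr hξ hk ih.1 ih.2 hmem
      obtain ⟨h1, hi, -⟩ := chosen_spec (N := N) (m := m) (g := g) (r := r) (ξ := ξ)
        (p := sorted (trialSet N m g r ξ k)) hk
      have hlt := hp.pred_lt h1 hi
      have hr1 : 1 / r < 1 := by rw [div_lt_one (by linarith)]; exact hr
      rw [sub_self, abs_zero] at h
      have := mul_pos (show 0 < (1 - 1 / r) / 2 by linarith) (sub_pos.2 hlt)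
      linarith
    · intro x hx
      rcases Finset.mem_insert.1 hx with rfl | hx
      · exact newPoint_mem hN hr hξ hk hp
      · exact ih.2 x hx

lemma mem_trialSet_iff {k : ℕ} {x : ℝ} (hk : 1 ≤ k) :
    x ∈ trialSet N m g r ξ k ↔ ∃ i ≤ k, trial N m g r ξ i = x := by
  induction k, hk using Nat.le_induction with
  | base =>
    simp only [trialSet, Finset.mem_insert, Finset.mem_singleton]
    constructor
    · rintro (rfl | rfl)
      · exact ⟨0, by simp, rfl⟩
      · exact ⟨1, le_rfl, rfl⟩
    · rintro ⟨i, hi, rfl⟩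
      interval_cases i <;> simp [trial]
  | succ k hk ih =>
    rw [trialSet_succ hk, Finset.mem_insert, ih]
    constructor
    · rintro (rfl | ⟨i, hi, rfl⟩)
      · exact ⟨k + 1, le_rfl, rfl⟩
      · exact ⟨i, by omega, rfl⟩
    · rintro ⟨i, hi, rfl⟩
      rcases hi.eq_or_lt with rfl | h
      · exact Or.inl rfl
      · exact Or.inr ⟨i, by omega, rfl⟩

lemma isPartition_node (hN : N ≠ 0) (hr : 1 < r) (hξ : 0 < ξ) {k : ℕ} (hk : 1 ≤ k) :
    IsPartition k (node N m g r ξ k) :=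
  isPartition_sorted (trialSet_card_and_mem hN hr hξ hk).1 (trialSet_card_and_mem hN hr hξ hk).2

lemma exists_trial_eq_node (hN : N ≠ 0) (hr : 1 < r) (hξ : 0 < ξ) {k i : ℕ} (hk : 1 ≤ k)
    (hi : i ≤ k) : ∃ l ≤ k, trial N m g r ξ l = node N m g r ξ k i :=
  (mem_trialSet_iff hk).1
    (sorted_mem (by have := (trialSet_card_and_mem (m := m) (g := g) hN hr hξ hk).1; omega))

lemma trial_mem (hN : N ≠ 0) (hr : 1 < r) (hξ : 0 < ξ) (k : ℕ) :
    trial N m g r ξ k ∈ Icc (0 : ℝ) 1 :=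
  (trialSet_card_and_mem (m := m) (g := g) (k := k + 1) hN hr hξ (by omega)).2 _
    ((mem_trialSet_iff (by omega)).2 ⟨k, by omega, rfl⟩)

end

/-- A sequence in `[0,1]` does not have infinitely many terms at a distance `≥ κ` from all
earlier ones. -/
lemma not_frequently_separated {u : ℕ → ℝ} (hu : ∀ k, u k ∈ Icc (0 : ℝ) 1) {κ : ℝ}
    (hκ : 0 < κ) : ¬ ∃ᶠ k in atTop, ∀ i ≤ k, κ ≤ |u (k + 1) - u i| := by
  intro h
  obtain ⟨φ, hφ, hsep⟩ := extraction_of_frequently_atTop h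
  obtain ⟨c, -, ψ, hψ, hlim⟩ := isCompact_Icc.tendsto_subseq (fun n => hu (φ n + 1))
  have hlim' := hlim.comp (tendsto_add_atTop_nat 1)
  have hd := (hlim'.sub hlim).abs
  rw [sub_self, abs_zero] at hd
  obtain ⟨n, hn⟩ := (hd.eventually (gt_mem_nhds hκ)).exists
  refine absurd hn (not_lt.2 (hsep _ _ ?_))
  -- The next member of the subsequence has index `φ (ψ (n + 1)) + 1`, and `φ (ψ n) + 1 ≤ φ (ψ (n +
  -- 1))` puts the present one among its predecessors.
  exact hφ (hψ (Nat.lt_succ_self n))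

/-! ### Accumulation of trial points near the solution -/

section

variable {N m : ℕ} {g : ℕ → ℝ → ℝ} {r ξ H : ℝ}

/-- Infinitely many trial points fall into the part of `[a,b]` near the solution. -/
lemma frequently_trial_mem (hN : N ≠ 0) (hH : 0 ≤ H) (hg : IndexLipschitz m g H)
    (hr : 1 < r) (hξ : 0 < ξ) {xs : ℝ} (hf : xs ∈ feasible m g)
    (hs : ∀ y ∈ feasible m g, g (m + 1) xs ≤ g (m + 1) y) {a b : ℝ}
    (hab : a < b) (hxs : xs ∈ Icc a b) {U : Set ℝ} (hU : U ∈ 𝓝[Icc a b] xs) {j : ℕ → ℕ}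
    (hj : ∀ k, 1 ≤ k → 1 ≤ j k ∧ j k ≤ k ∧
      xs ∈ Icc (node N m g r ξ k (j k - 1)) (node N m g r ξ k (j k)) ∧
      node N m g r ξ k (j k - 1) < b ∧ a < node N m g r ξ k (j k))
    (hpos : ∀ᶠ k in atTop, 0 < gap N m g r ξ xs k (j k))
    (hgap : ¬ Tendsto (fun k => gap N m g r ξ xs k (j k)) atTop (𝓝 0)) :
    ∃ᶠ k in atTop, trial N m g r ξ k ∈ U := by
  intro hev
  obtain ⟨k₀, hk₀⟩ := eventually_atTop.1 hev
  -- a punctured neighbourhood of the solution free of trial points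
  obtain ⟨σ, hσ, hfree⟩ : ∃ σ > 0, ∀ k, trial N m g r ξ k ∈ Icc a b →
      trial N m g r ξ k ≠ xs → σ ≤ |trial N m g r ξ k - xs| := by
    obtain ⟨σ₁, hσ₁, hball⟩ := Metric.mem_nhdsWithin_iff.1 hU
    -- Trials before `k₀` may lie in `U`, but they are finitely many; the solution itself is
    -- removed, since it may be a trial point.
    have hfin : ((Finset.range k₀).image (trial N m g r ξ) \ {xs} : Set ℝ).Finite :=
      (Finset.finite_toSet _).sdiff
    obtain ⟨σ₂, hσ₂, hball₂⟩ := Metric.isOpen_iff.1 hfin.isClosed.isOpen_compl xs (by simp)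
    refine ⟨min σ₁ σ₂, lt_min hσ₁ hσ₂, fun k hk hne => ?_⟩
    by_contra! hlt
    rcases Nat.lt_or_ge k k₀ with h | h
    · refine hball₂ (Metric.mem_ball.2 (hlt.trans_le (min_le_right _ _))) ⟨?_, hne⟩
      simp only [Finset.coe_image, Finset.coe_range]
      exact mem_image_of_mem _ h
    · exact hk₀ k h (hball ⟨Metric.mem_ball.2 (hlt.trans_le (min_le_left _ _)), hk⟩)
  -- On a side where `[a,b]` and the node interval both extend beyond the solution, the endpoint
  -- either is a trial point of `[a,b]`, hence `σ` away, or lies outside `[a,b]`, farther than the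
  -- end of `[a,b]`.
  obtain ⟨η, hη, hηle⟩ : ∃ η > 0, ∀ k, 1 ≤ k →
      η ≤ node N m g r ξ k (j k) - node N m g r ξ k (j k - 1) := by
    have hA : ∃ A > 0, a < xs → A ≤ xs - a := by
      rcases hxs.1.eq_or_lt with h | h
      · exact ⟨1, one_pos, fun h' => absurd h h'.ne⟩
      · exact ⟨xs - a, sub_pos.2 h, fun _ => le_rfl⟩
    have hB : ∃ B > 0, xs < b → B ≤ b - xs := by
      rcases hxs.2.eq_or_lt with h | h
      · exact ⟨1, one_pos, fun h' => absurd h h'.ne⟩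
      · exact ⟨b - xs, sub_pos.2 h, fun _ => le_rfl⟩
    obtain ⟨A, hA0, hA⟩ := hA
    obtain ⟨B, hB0, hB⟩ := hB
    refine ⟨min σ (min A B), by positivity, fun k hk => ?_⟩
    have e1 : min σ (min A B) ≤ σ := min_le_left _ _
    have e2 : min σ (min A B) ≤ A := (min_le_right _ _).trans (min_le_left _ _)
    have e3 : min σ (min A B) ≤ B := (min_le_right _ _).trans (min_le_right _ _)
    obtain ⟨h1, hjk, ⟨hl, hr'⟩, hlb, har⟩ := hj k hk
    have hlt := (isPartition_node (m := m) (g := g) hN hr hξ hk).pred_lt h1 hjk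
    obtain ⟨i₁, -, hi₁⟩ := exists_trial_eq_node (m := m) (g := g) hN hr hξ hk
      (show j k - 1 ≤ k by omega)
    obtain ⟨i₂, -, hi₂⟩ := exists_trial_eq_node (m := m) (g := g) hN hr hξ hk hjk
    have f1 := hfree i₁
    have f2 := hfree i₂
    rw [hi₁] at f1
    rw [hi₂] at f2
    set u := node N m g r ξ k (j k - 1)
    set v := node N m g r ξ k (j k)
    by_cases hc : xs < v ∧ xs < b
    · rcases le_or_gt v b with hvb | hvb
      · have := f2 ⟨har.le, hvb⟩ hc.1.ne'
        rw [abs_of_pos (by linarith)] at this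
        linarith
      · linarith [hB hc.2]
    -- If the right side fails, the left one works, because the node interval overlaps `[a,b]` in
    -- more than a point.
    · have hc' : u < xs ∧ a < xs := by
        by_contra hc'
        rw [not_and_or, not_lt, not_lt] at hc hc'
        rcases hc with h | h <;> rcases hc' with h' | h' <;> linarith
      rcases le_or_gt a u with hau | hau
      · have := f1 ⟨hau, hlb.le⟩ hc'.1.ne
        rw [abs_of_neg (by linarith)] at this
        linarith
      · linarith [hA hc'.2]
  -- the gap is infinitely often bounded below
  obtain ⟨δ, hδ, hfreq⟩ : ∃ δ > 0, ∃ᶠ k in atTop, δ ≤ gap N m g r ξ xs k (j k) := by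
    by_contra! hc
    refine hgap (Metric.tendsto_nhds.2 fun δ hδ => ?_)
    filter_upwards [hc δ hδ, hpos] with k h1 h2
    rw [Real.dist_eq, sub_zero, abs_of_pos h2]
    exact h1
  have hB : 0 < r * max H ξ := mul_pos (by linarith) (hξ.trans_le (le_max_right _ _))
  set c := min ((δ / (r * max H ξ)) ^ 2) (2 * (δ / (r * max H ξ))) with hc
  have hc0 : 0 < c := by positivity
  have hL0 : 0 < hlen N 0 η := hlen_pos hη
  have hr1 : 1 / r < 1 := by rw [div_lt_one (by linarith)]; exact hr
  have hρ : 0 < hlen N 0 η * c / 2 := by positivity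
  -- The characteristic is at least `hlen N 0 η * c` and at most twice the Hölder length of the
  -- chosen interval, whose ordinary length is therefore at least the `N`-th power in `κ`.
  refine not_frequently_separated (u := trial N m g r ξ) (trial_mem hN hr hξ)
    (κ := (1 - 1 / r) / 2 * (hlen N 0 η * c / 2) ^ N)
    (mul_pos (by linarith) (by positivity)) ?_
  refine (hfreq.and_eventually (eventually_ge_atTop 1)).mono ?_
  rintro k ⟨hk, hk1⟩ i hi
  have hp := isPartition_node (m := m) (g := g) hN hr hξ hk1
  obtain ⟨hcard, h01⟩ := trialSet_card_and_mem (m := m) (g := g) hN hr hξ hk1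
  obtain ⟨h1, hjk, hx, -, -⟩ := hj k hk1
  obtain ⟨ht1, htk, hmax⟩ := chosen_spec (N := N) (m := m) (g := g) (r := r) (ξ := ξ)
    (p := node N m g r ξ k) hk1
  rw [trial_succ hk1]
  refine le_trans ?_ (le_abs_newPoint_sub hN hr hξ hk1 hcard h01
    ((mem_trialSet_iff hk1).2 ⟨i, hi, rfl⟩))
  refine mul_le_mul_of_nonneg_left ?_ (by linarith)
  have hlow := le_charR hN hp hH hg hr hξ hf hs h1 hjk hx hδ hk
  have hup := charR_le (N := N) (m := m) (g := g) hp hr hξ ht1 htk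
  have hL : hlen N 0 η ≤ hlen N (node N m g r ξ k (j k - 1)) (node N m g r ξ k (j k)) :=
    hlen_le_hlen hη.le (by simpa using hηle k hk1)
  have hLc := mul_le_mul_of_nonneg_right hL hc0.le
  have hfin := hmax _ h1 hjk
  have hpow := pow_le_pow_left₀ hρ.le
    (show hlen N 0 η * c / 2 ≤ hlen N (node N m g r ξ k (chosen N m g r ξ k (node N m g r ξ k) - 1))
      (node N m g r ξ k (chosen N m g r ξ k (node N m g r ξ k))) by linarith) N
  exact hpow.trans_eq (hlen_pow hN (hp.pred_lt ht1 htk).le)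

end

/-! ### Polygonal curves -/

section polygon

variable {F : Type*} [NormedAddCommGroup F] [NormedSpace ℝ F]

/-- The broken line with the vertices `c 0, c 1, …`, one link per unit of time. -/
noncomputable def polygon (c : ℕ → F) (w : ℝ) : F :=
  c ⌊w⌋₊ + (w - (⌊w⌋₊ : ℝ)) • (c (⌊w⌋₊ + 1) - c ⌊w⌋₊)

/-- The closed interval includes `w = n + 1`, where the floor jumps but adjoining links agree. -/
lemma polygon_eq (c : ℕ → F) (n : ℕ) {w : ℝ} (h : w ∈ Icc (n : ℝ) (n + 1)) :
    polygon c w = c n + (w - n) • (c (n + 1) - c n) := by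
  rcases h.2.eq_or_lt with h' | h'
  · have : ⌊w⌋₊ = n + 1 := by
      rw [h']; exact_mod_cast Nat.floor_natCast (R := ℝ) (n + 1)
    rw [polygon, this, h']
    simp
  · have : ⌊w⌋₊ = n := (Nat.floor_eq_iff (n.cast_nonneg.trans h.1)).2 ⟨h.1, h'⟩
    rw [polygon, this]

lemma polygon_natCast (c : ℕ → F) (n : ℕ) : polygon c n = c n := by
  simp [polygon]

/-- The longest link serves as constant; a pair on both sides of a vertex is split there. -/
lemma exists_polygon_lipschitz (c : ℕ → F) (n : ℕ) :
    ∃ K : ℝ, 0 ≤ K ∧ ∀ x y : ℝ, 0 ≤ x → x ≤ y → y ≤ n →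
      ‖polygon c x - polygon c y‖ ≤ K * (y - x) := by
  induction n with
  | zero =>
    refine ⟨0, le_rfl, fun x y hx hxy hy => ?_⟩
    have : x = y := by push_cast at hy; linarith
    simp [this]
  | succ n ih =>
    obtain ⟨K, hK, h⟩ := ih
    have hlink : ∀ x y : ℝ, (n : ℝ) ≤ x → x ≤ y → y ≤ n + 1 →
        ‖polygon c x - polygon c y‖ ≤ ‖c (n + 1) - c n‖ * (y - x) := by
      intro x y hx hxy hy
      rw [polygon_eq c n ⟨hx, hxy.trans hy⟩, polygon_eq c n ⟨hx.trans hxy, hy⟩,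
        add_sub_add_left_eq_sub, ← sub_smul, norm_smul, Real.norm_eq_abs, abs_sub_comm,
        abs_of_nonneg (by linarith), mul_comm]
      exact mul_le_mul_of_nonneg_left (by linarith) (norm_nonneg _)
    refine ⟨max K ‖c (n + 1) - c n‖, hK.trans (le_max_left _ _), fun x y hx hxy hy => ?_⟩
    push_cast at hy
    have hl : ∀ u v : ℝ, u ≤ v → K * (v - u) ≤ max K ‖c (n + 1) - c n‖ * (v - u) :=
      fun u v huv => mul_le_mul_of_nonneg_right (le_max_left _ _) (sub_nonneg.2 huv)
    have hr : ∀ u v : ℝ, u ≤ v →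
        ‖c (n + 1) - c n‖ * (v - u) ≤ max K ‖c (n + 1) - c n‖ * (v - u) :=
      fun u v huv => mul_le_mul_of_nonneg_right (le_max_right _ _) (sub_nonneg.2 huv)
    rcases le_total y n with hyn | hyn
    · exact (h x y hx hxy hyn).trans (hl x y hxy)
    rcases le_total (n : ℝ) x with hxn | hxn
    · exact (hlink x y hxn hxy hy).trans (hr x y hxy)
    · have h1 := (h x n hx hxn le_rfl).trans (hl _ _ hxn)
      have h2 := (hlink n y le_rfl hyn hy).trans (hr _ _ hyn)
      have h3 := norm_sub_le_norm_sub_add_norm_sub (polygon c x) (polygon c n) (polygon c y)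
      linarith

lemma polygon_mem {s : Set F} (hs : Convex ℝ s) {c : ℕ → F} {n : ℕ}
    (hc : ∀ i ≤ n, c i ∈ s) {w : ℝ} (hw : w ∈ Icc (0 : ℝ) n) : polygon c w ∈ s := by
  rcases hw.2.eq_or_lt with h | h
  · rw [h, polygon_natCast]; exact hc n le_rfl
  · have h1 : ⌊w⌋₊ < n := (Nat.floor_lt hw.1).2 h
    rw [polygon]
    refine hs.add_smul_sub_mem (hc _ h1.le) (hc _ h1) ⟨?_, ?_⟩
    · linarith [Nat.floor_le hw.1]
    · linarith [Nat.lt_floor_add_one w]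

end polygon

/-! ### The curve -/

lemma convex_domain (N : ℕ) : Convex ℝ (domain N) := by
  intro x hx y hy a b ha hb hab i
  have h1 := hx i
  have h2 := hy i
  simp only [PiLp.add_apply, PiLp.smul_apply, smul_eq_mul]
  constructor <;> nlinarith

lemma isClosed_domain (N : ℕ) : IsClosed (domain N) := by
  have : domain N = ⋂ i, {y : E N | -(1 / 2 : ℝ) ≤ y i ∧ y i ≤ 1 / 2} := by
    ext y; simp [domain]
  rw [this]
  refine isClosed_iInter fun i => ?_
  exact isClosed_Icc.preimage (f := fun y : E N => y i) (by fun_prop)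

lemma dist_le_of_coord {N : ℕ} {x y : E N} {δ : ℝ} (hδ : 0 ≤ δ)
    (h : ∀ i, |x i - y i| ≤ δ) : dist x y ≤ √N * δ := by
  rw [EuclideanSpace.dist_eq]
  calc √(∑ i, dist (x i) (y i) ^ 2) ≤ √(∑ _i : Fin N, δ ^ 2) := by
        refine Real.sqrt_le_sqrt (Finset.sum_le_sum fun i _ => ?_)
        rw [Real.dist_eq]
        exact pow_le_pow_left₀ (abs_nonneg _) (h i) 2
    _ = √N * δ := by
        rw [Finset.sum_const, Finset.card_univ, Fintype.card_fin, nsmul_eq_mul,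
          Real.sqrt_mul (Nat.cast_nonneg N), Real.sqrt_sq hδ]

lemma isCompact_domain (N : ℕ) : IsCompact (domain N) := by
  refine Metric.isCompact_of_isClosed_isBounded (isClosed_domain N) ?_
  refine (Metric.isBounded_iff_subset_closedBall (0 : E N)).2 ⟨√N * (1 / 2), fun y hy => ?_⟩
  exact dist_le_of_coord (by norm_num) fun i => by
    simpa [abs_le] using hy i

section curve

variable {N : ℕ} (P : PeanoNumbering N)

lemma curve_eq_polygon (d : ℕ) (x : ℝ) :
    P.curve d x = polygon (P.center d) (x * ((2 ^ (N * d) - 1 : ℕ) : ℝ)) := by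
  rw [Nat.cast_pred (by positivity)]
  push_cast
  rfl

lemma center_mem {d s : ℕ} (hs : s < 2 ^ (N * d)) : P.center d s ∈ domain N := by
  intro i
  have h : P.cube d s i < 2 ^ d := (P.bijOn d).mapsTo hs i
  have h' : (P.cube d s i : ℝ) + 1 ≤ 2 ^ d := by exact_mod_cast h
  have h2 : (0 : ℝ) < 2 ^ d := by positivity
  have h0 : (0 : ℝ) ≤ P.cube d s i := Nat.cast_nonneg _
  simp only [PeanoNumbering.center]
  have e1 : 0 ≤ ((P.cube d s i : ℝ) + 1 / 2) / 2 ^ d := by positivity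
  have e2 : ((P.cube d s i : ℝ) + 1 / 2) / 2 ^ d ≤ 1 := by
    rw [div_le_one h2]; linarith
  constructor <;> linarith

lemma curve_mem (d : ℕ) {x : ℝ} (hx : x ∈ Icc (0 : ℝ) 1) : P.curve d x ∈ domain N := by
  rw [curve_eq_polygon]
  have hpos : 0 < 2 ^ (N * d) := by positivity
  refine polygon_mem (convex_domain N) (n := 2 ^ (N * d) - 1)
    (fun i hi => center_mem P (by omega)) ⟨mul_nonneg hx.1 (Nat.cast_nonneg _), ?_⟩
  exact mul_le_of_le_one_left (Nat.cast_nonneg _) hx.2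

lemma exists_curve_lipschitz (d : ℕ) : ∃ K : ℝ, 0 ≤ K ∧ ∀ x ∈ Icc (0 : ℝ) 1,
    ∀ y ∈ Icc (0 : ℝ) 1, ‖P.curve d x - P.curve d y‖ ≤ K * |x - y| := by
  obtain ⟨K, hK, h⟩ := exists_polygon_lipschitz (P.center d) (2 ^ (N * d) - 1)
  set W : ℝ := ((2 ^ (N * d) - 1 : ℕ) : ℝ) with hW
  have hW0 : 0 ≤ W := Nat.cast_nonneg _
  have key : ∀ x ∈ Icc (0 : ℝ) 1, ∀ y ∈ Icc (0 : ℝ) 1, x ≤ y →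
      ‖P.curve d x - P.curve d y‖ ≤ K * W * |x - y| := by
    intro x hx y hy hxy
    rw [curve_eq_polygon, curve_eq_polygon, abs_sub_comm, abs_of_nonneg (by linarith)]
    refine (h (x * W) (y * W) (mul_nonneg hx.1 hW0) (mul_le_mul_of_nonneg_right hxy hW0)
      (mul_le_of_le_one_left hW0 hy.2)).trans_eq ?_
    ring
  refine ⟨K * W, mul_nonneg hK hW0, fun x hx y hy => ?_⟩
  rcases le_total x y with hxy | hxy
  · exact key x hx y hy hxy
  · rw [norm_sub_rev, abs_sub_comm]
    exact key y hy x hx hxy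

lemma continuousOn_curve (d : ℕ) : ContinuousOn (P.curve d) (Icc 0 1) := by
  obtain ⟨K, hK, h⟩ := exists_curve_lipschitz P d
  refine (LipschitzOnWith.of_dist_le_mul (K := ⟨K, hK⟩) fun x hx y hy => ?_).continuousOn
  rw [dist_eq_norm, Real.dist_eq]
  exact h x hx y hy

lemma exists_curve_eq_center {d s : ℕ} (hs : s < 2 ^ (N * d)) :
    ∃ x ∈ Icc (0 : ℝ) 1, P.curve d x = P.center d s := by
  -- At level `0` there is a single centre and the number of links, the denominator below, is `0`.
  rcases Nat.eq_zero_or_pos s with rfl | h0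
  · exact ⟨0, by simp, by simp [curve_eq_polygon, polygon]⟩
  have hW : (0 : ℝ) < ((2 ^ (N * d) - 1 : ℕ) : ℝ) := by
    exact_mod_cast (by omega : 0 < 2 ^ (N * d) - 1)
  have hsW : (s : ℝ) ≤ ((2 ^ (N * d) - 1 : ℕ) : ℝ) := by
    exact_mod_cast (by omega : s ≤ 2 ^ (N * d) - 1)
  refine ⟨s / ((2 ^ (N * d) - 1 : ℕ) : ℝ), ⟨by positivity, (div_le_one hW).2 hsW⟩, ?_⟩
  rw [curve_eq_polygon, div_mul_cancel₀ _ hW.ne', polygon_natCast]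

/-- Every point of the domain is near to the level-`d` curve. -/
lemma exists_curve_dist_le (d : ℕ) {y : E N} (hy : y ∈ domain N) :
    ∃ x ∈ Icc (0 : ℝ) 1, dist (P.curve d x) y ≤ √N * (1 / 2) ^ d := by
  have h2 : (0 : ℝ) < 2 ^ d := by positivity
  have hcell : ∀ t : ℝ, -(1 / 2) ≤ t ∧ t ≤ 1 / 2 → ∃ c : ℕ, c < 2 ^ d ∧
      |-(1 / 2 : ℝ) + ((c : ℝ) + 1 / 2) / 2 ^ d - t| ≤ (1 / 2) ^ d := by
    rintro t ⟨hl, hu⟩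
    have ht0 : 0 ≤ (t + 1 / 2) * 2 ^ d := mul_nonneg (by linarith) h2.le
    have ht1 : (t + 1 / 2) * 2 ^ d ≤ 2 ^ d := mul_le_of_le_one_left h2.le (by linarith)
    -- On the face `t = 1 / 2` the floor would be `2 ^ d`, one past the last cell.
    have hc : ∃ c : ℕ, c < 2 ^ d ∧ |(c : ℝ) + 1 / 2 - (t + 1 / 2) * 2 ^ d| ≤ 1 := by
      rcases ht1.eq_or_lt with h | h
      · refine ⟨2 ^ d - 1, Nat.sub_lt (by positivity) one_pos, ?_⟩
        rw [h, Nat.cast_pred (by positivity)]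
        push_cast
        rw [abs_le]; constructor <;> linarith
      · refine ⟨⌊(t + 1 / 2) * 2 ^ d⌋₊, ?_, ?_⟩
        · rw [Nat.floor_lt ht0]; push_cast; exact h
        · have := Nat.floor_le ht0
          have := Nat.lt_floor_add_one ((t + 1 / 2) * 2 ^ d)
          rw [abs_le]; constructor <;> linarith
    obtain ⟨c, hc, hcy⟩ := hc
    refine ⟨c, hc, ?_⟩
    have e : -(1 / 2 : ℝ) + ((c : ℝ) + 1 / 2) / 2 ^ d - t =
        ((c : ℝ) + 1 / 2 - (t + 1 / 2) * 2 ^ d) / 2 ^ d := by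
      field_simp; ring
    rw [e, abs_div, abs_of_pos h2, one_div_pow]
    exact div_le_div_of_nonneg_right hcy h2.le
  choose c hc hcy using fun i => hcell (y i) (hy i)
  obtain ⟨s, hs, hsc⟩ := (P.bijOn d).surjOn (a := c) hc
  obtain ⟨x, hx, hxs⟩ := exists_curve_eq_center P hs
  refine ⟨x, hx, dist_le_of_coord (by positivity) fun i => ?_⟩
  rw [hxs]
  simpa [PeanoNumbering.center, hsc] using hcy i

/-- The curves of high level pass through every given neighbourhood of a point of the domain. -/
lemma eventually_exists_curve_mem_ball {y : E N} (hy : y ∈ domain N) {δ : ℝ} (hδ : 0 < δ) :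
    ∀ᶠ d in atTop, ∃ x ∈ Icc (0 : ℝ) 1, P.curve d x ∈ Metric.ball y δ := by
  have h : Tendsto (fun d : ℕ => √N * (1 / 2 : ℝ) ^ d) atTop (𝓝 (√N * 0)) :=
    (tendsto_pow_atTop_nhds_zero_of_lt_one (by norm_num) (by norm_num)).const_mul _
  rw [mul_zero] at h
  filter_upwards [h.eventually (gt_mem_nhds hδ)] with d hd
  obtain ⟨x, hx, hxy⟩ := exists_curve_dist_le P d hy
  exact ⟨x, hx, Metric.mem_ball.2 (hxy.trans_lt hd)⟩

end curve

/-! ### The feasible region -/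

section region

variable {N m : ℕ} {G : ℕ → E N → ℝ} {L : ℕ → ℝ}

lemma region_one : region G 1 = domain N := by
  ext y
  exact ⟨fun h => h.1, fun h => ⟨h, fun l h1 h2 => absurd h1 (by omega)⟩⟩

lemma region_succ {i : ℕ} (hi : 1 ≤ i) :
    region G (i + 1) = {y | y ∈ region G i ∧ G i y ≤ 0} := by
  ext y
  constructor
  · exact fun h => ⟨⟨h.1, fun l h1 h2 => h.2 l h1 (by omega)⟩, h.2 i hi (by omega)⟩
  · rintro ⟨h, h'⟩
    refine ⟨h.1, fun l h1 h2 => ?_⟩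
    rcases (Nat.lt_succ_iff.1 h2).eq_or_lt with rfl | h3
    · exact h'
    · exact h.2 l h1 h3

lemma continuousOn_of_lipschitz
    (hLip : ∀ i, 1 ≤ i → i ≤ m + 1 → ∀ y' ∈ region G i, ∀ y'' ∈ region G i,
      |G i y' - G i y''| ≤ L i * ‖y' - y''‖) {i : ℕ} (h1 : 1 ≤ i) (hi : i ≤ m + 1) :
    ContinuousOn (G i) (region G i) := by
  refine (LipschitzOnWith.of_dist_le_mul (K := (L i).toNNReal) fun x hx y hy => ?_).continuousOn
  rw [Real.dist_eq, dist_eq_norm]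
  exact (hLip i h1 hi x hx y hy).trans
    (mul_le_mul_of_nonneg_right (Real.le_coe_toNNReal _) (norm_nonneg _))

/-- Induction is needed because `G i` is continuous only on its own region, so each sublevel set is
closed relative to the preceding compact one. -/
lemma isCompact_region
    (hLip : ∀ i, 1 ≤ i → i ≤ m + 1 → ∀ y' ∈ region G i, ∀ y'' ∈ region G i,
      |G i y' - G i y''| ≤ L i * ‖y' - y''‖) {i : ℕ} (h1 : 1 ≤ i) (hi : i ≤ m + 1) :
    IsCompact (region G i) := by
  induction i, h1 using Nat.le_induction with
  | base => rw [region_one]; exact isCompact_domain N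
  | succ i h1 ih =>
    have hc := ih (by omega)
    rw [region_succ h1]
    exact hc.of_isClosed_subset
      ((continuousOn_of_lipschitz hLip h1 (by omega)).preimage_isClosed_of_isClosed hc.isClosed
        isClosed_Iic) fun y hy => hy.1

/-- Every neighbourhood of a point of a robust union contains a ball of the union. -/
lemma exists_ball_subset_of_isRobustUnion {Q : Set (E N)} (hQ : IsRobustUnion Q) {y : E N}
    (hy : y ∈ Q) {δ : ℝ} (hδ : 0 < δ) :
    ∃ u, ∃ η > 0, Metric.ball u η ⊆ Metric.ball y δ ∩ Q := by
  obtain ⟨T, A, -, rfl, hA⟩ := hQ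
  obtain ⟨a, ha⟩ := mem_iUnion.1 hy
  have hne : (interior (Metric.ball y δ ∩ A a)).Nonempty := by
    -- A point of the piece is either interior or on its frontier, where robustness applies.
    by_cases hi : y ∈ interior (A a)
    · refine ⟨y, ?_⟩
      rw [interior_inter, Metric.isOpen_ball.interior_eq]
      exact ⟨Metric.mem_ball_self hδ, hi⟩
    · exact (hA a).2 y ⟨subset_closure ha, hi⟩ δ hδ
  obtain ⟨u, hu⟩ := hne
  obtain ⟨η, hη, hsub⟩ := Metric.isOpen_iff.1 isOpen_interior u hu
  exact ⟨u, η, hη, fun z hz =>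
    ⟨(interior_subset (hsub hz)).1, mem_iUnion.2 ⟨a, (interior_subset (hsub hz)).2⟩⟩⟩

/-- Curves of high level meet the feasible region in any neighbourhood of a feasible point. -/
lemma eventually_exists_curve_mem_region (P : PeanoNumbering N)
    (hRob : ∀ i, 2 ≤ i → i ≤ m + 1 → IsRobustUnion (region G i))
    {y : E N} (hy : y ∈ region G (m + 1)) {δ : ℝ} (hδ : 0 < δ) :
    ∀ᶠ d in atTop, ∃ x ∈ Icc (0 : ℝ) 1, P.curve d x ∈ region G (m + 1) ∩ Metric.ball y δ := by
  -- For `m = 0` the feasible region is the whole domain, which `hRob` does not cover but the curve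
  -- never leaves.
  rcases Nat.eq_zero_or_pos m with rfl | hm
  · filter_upwards [eventually_exists_curve_mem_ball P hy.1 hδ] with d ⟨x, hx, hxy⟩
    refine ⟨x, hx, ?_, hxy⟩
    rw [zero_add, region_one]
    exact curve_mem P d hx
  · obtain ⟨u, η, hη, hsub⟩ :=
      exists_ball_subset_of_isRobustUnion (hRob (m + 1) (by omega) le_rfl) hy hδ
    have hu : u ∈ domain N := (hsub (Metric.mem_ball_self hη)).2.1
    filter_upwards [eventually_exists_curve_mem_ball P hu hη] with d ⟨x, hx, hxu⟩
    exact ⟨x, hx, (hsub hxu).2, (hsub hxu).1⟩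

/-- Near-optimal points of a compact set are near the unique minimiser. -/
lemma exists_pos_forall_mem_ball {X : Type*} [MetricSpace X] {Q : Set X} {f : X → ℝ}
    (hQ : IsCompact Q) (hf : ContinuousOn f Q) {y₀ : X}
    (hmin : ∀ y ∈ Q, y ≠ y₀ → f y₀ < f y) {ε : ℝ} (hε : 0 < ε) :
    ∃ ρ > 0, ∀ y ∈ Q, f y < f y₀ + ρ → y ∈ Metric.ball y₀ ε := by
  have hK : IsCompact (Q \ Metric.ball y₀ ε) := hQ.diff Metric.isOpen_ball
  rcases (Q \ Metric.ball y₀ ε).eq_empty_or_nonempty with h | h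
  · exact ⟨1, one_pos, fun y hy _ => sdiff_eq_empty.1 h hy⟩
  · obtain ⟨z, hz, hzmin⟩ := hK.exists_isMinOn h (hf.mono sdiff_subset)
    have hne : z ≠ y₀ := fun h => hz.2 (h ▸ Metric.mem_ball_self hε)
    -- The margin by which the best point outside the ball loses to `y₀`.
    refine ⟨f z - f y₀, sub_pos.2 (hmin z hz.1 hne), fun y hy hlt => ?_⟩
    by_contra hc
    have : f z ≤ f y := hzmin ⟨hy, hc⟩
    linarith

lemma mem_feasible_reduced_iff (P : PeanoNumbering N) (d : ℕ) (x : ℝ) :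
    x ∈ feasible m (reduced P G d) ↔
      x ∈ Icc (0 : ℝ) 1 ∧ P.curve d x ∈ region G (m + 1) :=
  ⟨fun h => ⟨h.1, curve_mem P d h.1, h.2⟩, fun h => ⟨h.1, h.2.2⟩⟩

lemma exists_indexLipschitz_reduced
    (hLip : ∀ i, 1 ≤ i → i ≤ m + 1 → ∀ y' ∈ region G i, ∀ y'' ∈ region G i,
      |G i y' - G i y''| ≤ L i * ‖y' - y''‖) (P : PeanoNumbering N) (d : ℕ) :
    ∃ H, 0 ≤ H ∧ IndexLipschitz m (reduced P G d) H := by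
  obtain ⟨K, hK, h⟩ := exists_curve_lipschitz P d
  -- One constant for all indices; absolute values, since `L i` may be negative.
  have hLs : ∀ i ∈ Finset.range (m + 2), |L i| ≤ ∑ l ∈ Finset.range (m + 2), |L l| :=
    fun i hi => Finset.single_le_sum (f := fun l => |L l|) (fun _ _ => abs_nonneg _) hi
  refine ⟨(∑ l ∈ Finset.range (m + 2), |L l|) * K, by positivity,
    fun i h1 hi x hx y hy hxi hyi => ?_⟩
  have hL : L i ≤ ∑ l ∈ Finset.range (m + 2), |L l| :=
    (le_abs_self _).trans (hLs i (Finset.mem_range.2 (by omega)))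
  refine (hLip i h1 hi _ ⟨curve_mem P d hx, hxi⟩ _ ⟨curve_mem P d hy, hyi⟩).trans ?_
  rw [mul_assoc]
  exact mul_le_mul hL (h x hx y hy) (norm_nonneg _) (by positivity)

lemma exists_isMinOn_feasible_reduced
    (hLip : ∀ i, 1 ≤ i → i ≤ m + 1 → ∀ y' ∈ region G i, ∀ y'' ∈ region G i,
      |G i y' - G i y''| ≤ L i * ‖y' - y''‖) (P : PeanoNumbering N) {d : ℕ}
    (hne : (feasible m (reduced P G d)).Nonempty) :
    ∃ x ∈ feasible m (reduced P G d), ∀ y ∈ feasible m (reduced P G d),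
      reduced P G d (m + 1) x ≤ reduced P G d (m + 1) y := by
  have hset : feasible m (reduced P G d) = Icc 0 1 ∩ P.curve d ⁻¹' region G (m + 1) :=
    Set.ext fun x => mem_feasible_reduced_iff P d x
  have hcpt : IsCompact (feasible m (reduced P G d)) := by
    rw [hset]
    exact isCompact_Icc.of_isClosed_subset
      ((continuousOn_curve P d).preimage_isClosed_of_isClosed isClosed_Icc
        (isCompact_region hLip (by omega) le_rfl).isClosed) inter_subset_left
  refine hcpt.exists_isMinOn (f := reduced P G d (m + 1)) hne ?_
  exact (continuousOn_of_lipschitz hLip (by omega) le_rfl).comp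
    ((continuousOn_curve P d).mono fun x hx => hx.1)
    fun x hx => ((mem_feasible_reduced_iff P d x).1 hx).2

end region

end IndexMethod

/-! ### The main theorem -/

theorem corollary1 {N : ℕ} (hN : 2 ≤ N) (m : ℕ)
    (G : ℕ → IndexMethod.E N → ℝ) (L : ℕ → ℝ)
    (hLip : ∀ i, 1 ≤ i → i ≤ m + 1 →
      ∀ y' ∈ IndexMethod.region G i, ∀ y'' ∈ IndexMethod.region G i,
        |G i y' - G i y''| ≤ L i * ‖y' - y''‖)
    (hRob : ∀ i, 2 ≤ i → i ≤ m + 1 → IndexMethod.IsRobustUnion (IndexMethod.region G i))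
    (ys : IndexMethod.E N) (hys : ys ∈ IndexMethod.region G (m + 1))
    (hmin : ∀ y ∈ IndexMethod.region G (m + 1), y ≠ ys → G (m + 1) ys < G (m + 1) y)
    (P : IndexMethod.PeanoNumbering N) (ε : ℝ) (hε : 0 < ε) :
    ∃ d₀ : ℕ, ∀ d : ℕ, d₀ ≤ d →
      (∃ xs, IndexMethod.IsSolution m (IndexMethod.reduced P G d) xs) ∧
      ∀ xs, IndexMethod.IsSolution m (IndexMethod.reduced P G d) xs →
        P.curve d xs ∈ IndexMethod.region G (m + 1) ∩ Metric.ball ys ε ∧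
        -- a segment `h` of the curve in the feasible region, of positive length, through `xs`
        ∀ a b : ℝ, 0 ≤ a → a < b → b ≤ 1 → xs ∈ Icc a b →
          (∀ x ∈ Icc a b, P.curve d x ∈ IndexMethod.region G (m + 1)) →
        ∀ r ξ : ℝ, 1 < r → 0 < ξ →
        -- `j k` is the number of an interval containing `xs` in the `k`-th iteration
        -- (on the side of `h`, if there are two)
        ∀ j : ℕ → ℕ,
          (∀ k, 1 ≤ k → 1 ≤ j k ∧ j k ≤ k ∧
            xs ∈ Icc (IndexMethod.node N m (IndexMethod.reduced P G d) r ξ k (j k - 1))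
              (IndexMethod.node N m (IndexMethod.reduced P G d) r ξ k (j k)) ∧
            IndexMethod.node N m (IndexMethod.reduced P G d) r ξ k (j k - 1) < b ∧
            a < IndexMethod.node N m (IndexMethod.reduced P G d) r ξ k (j k)) →
        ∀ ks : ℕ, 1 ≤ ks →
          (∀ k, ks ≤ k →
            0 < IndexMethod.gap N m (IndexMethod.reduced P G d) r ξ xs k (j k)) →
          ¬ Tendsto (fun k => IndexMethod.gap N m (IndexMethod.reduced P G d) r ξ xs k (j k))
              atTop (𝓝 0) →
        ∃ᶠ k in atTop,
          P.curve d (IndexMethod.trial N m (IndexMethod.reduced P G d) r ξ k) ∈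
            IndexMethod.region G (m + 1) ∩ Metric.ball ys ε := by
  obtain ⟨ρ, hρ, hball⟩ := IndexMethod.exists_pos_forall_mem_ball
    (IndexMethod.isCompact_region hLip (by omega) le_rfl)
    (IndexMethod.continuousOn_of_lipschitz hLip (by omega) le_rfl) hmin hε
  -- Within this radius the objective changes by less than `ρ`; the `+ 1` keeps the denominator
  -- positive.
  have hδ : 0 < ρ / (|L (m + 1)| + 1) := by positivity
  obtain ⟨d₀, hd₀⟩ := eventually_atTop.1
    (IndexMethod.eventually_exists_curve_mem_region P hRob hys hδ)
  refine ⟨d₀, fun d hd => ?_⟩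
  obtain ⟨x₁, hx₁, hx₁Q, hx₁b⟩ := hd₀ d hd
  have hx₁f := (IndexMethod.mem_feasible_reduced_iff (m := m) (G := G) P d x₁).2 ⟨hx₁, hx₁Q⟩
  have hx₁lt : G (m + 1) (P.curve d x₁) < G (m + 1) ys + ρ := by
    have h1 := hLip (m + 1) (by omega) le_rfl _ hx₁Q _ hys
    rw [Metric.mem_ball, dist_eq_norm, lt_div_iff₀ (by positivity)] at hx₁b
    have h2 : L (m + 1) * ‖P.curve d x₁ - ys‖ ≤ |L (m + 1)| * ‖P.curve d x₁ - ys‖ :=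
      mul_le_mul_of_nonneg_right (le_abs_self _) (norm_nonneg _)
    linarith [le_abs_self (G (m + 1) (P.curve d x₁) - G (m + 1) ys),
      norm_nonneg (P.curve d x₁ - ys)]
  obtain ⟨x₀, hx₀, hx₀min⟩ := IndexMethod.exists_isMinOn_feasible_reduced hLip P ⟨x₁, hx₁f⟩
  have hsol := IndexMethod.isSolution_iff hx₀ hx₀min
  refine ⟨⟨x₀, (hsol x₀).2 ⟨hx₀, hx₀min⟩⟩, fun xs hxs => ?_⟩
  obtain ⟨hf, hs⟩ := (hsol xs).1 hxs
  have hfQ := (IndexMethod.mem_feasible_reduced_iff P d xs).1 hf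
  -- A solution does at least as well as `x₁`, which is already within `ρ` of the optimum.
  have hmem : P.curve d xs ∈ Metric.ball ys ε :=
    hball _ hfQ.2 ((hs x₁ hx₁f).trans_lt hx₁lt)
  refine ⟨⟨hfQ.2, hmem⟩, ?_⟩
  intro a b ha hab hb hxab hh r ξ hr hξ j hj ks _ hpos hgap
  obtain ⟨H, hH, hg⟩ := IndexMethod.exists_indexLipschitz_reduced hLip P d
  refine IndexMethod.frequently_trial_mem (U := P.curve d ⁻¹'
      (IndexMethod.region G (m + 1) ∩ Metric.ball ys ε)) (by omega) hH hg hr hξ hf hs hab hxab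
    ?_ hj (eventually_atTop.2 ⟨ks, hpos⟩) hgap
  -- Only a neighbourhood relative to `[a,b]` is available: the solution may be an endpoint, and
  -- feasibility is known on `[a,b]` alone.
  have hcont : ContinuousWithinAt (P.curve d) (Icc a b) xs :=
    ((IndexMethod.continuousOn_curve P d).mono (Icc_subset_Icc ha hb)) xs hxab
  filter_upwards [hcont (Metric.isOpen_ball.mem_nhds hmem), self_mem_nhdsWithin] with x hx hx'
  exact ⟨hh x hx', hx⟩
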